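/- Let $F$ be a finite field, let $1\le k\le n$, $d=n-k+1$, and let $x_1,\dots,x_n\in F$ be distinct and nonzero and $v_1,\dots,v_n\in F$ nonzero. Let $\mathcal C=\{c\in F^n:\ \sum_i c_iv_ix_i^{\,j}=0,\ 0\le j<n-k\}$ be the corresponding $(n,k,d)$ generalized Reed–Solomon code. (The Reed–Solomon code over $F=\mathrm{GF}(q)$, $n<q$, whose codewords are the polynomials $c_0+\dots+c_{n-1}X^{n-1}$ divisible by $\prod_{i=0}^{n-k-1}(X-\alpha^{m_0+i})$, with $\alpha$ primitive and $m_0\in\mathbb Z$, is the case of the locators $\alpha^i$ and multipliers $\alpha^{m_0i}$, $0\le i<n$.) Let $t\ge 0$ be an integer with $$t<n-\sqrt{n(n-d)}=n\bigl(1-\sqrt{1-d/n}\bigr),\qquad 2t\ne d,$$ put $t_0=d/2$, $m=\Bigl\lfloor\frac{2(t-t_0)(n-t)}{t^2-2n(t-t_0)}+1\Bigr\rfloor$ and $P_y=\Bigl\lfloor\frac{tm}{2t-2t_0}\Bigr\rfloor$. (For $2t<d$ the values of $m$ and $P_y$ are irrelevant, since step 4 below is not reached.) Given $R\in F^n$,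 the algorithm does the following. 1. Compute the syndromes $S_j=\sum_iR_iv_ix_i^{\,j}$, $0\le j<n-k$. 2. Berlekamp–Massey: start with $\Lambda=B=1$, $L_\Lambda=L_B=0$. For $r=0,\dots,n-k-1$ let $\Delta=\sum_{i=0}^{L_\Lambda}\Lambda_iS_{r-i}$ and replace $(\Lambda,B,L_\Lambda,L_B)$ by $(\Lambda-\Delta XB,\ \Delta^{-1}\Lambda,\ L_B+1,\ L_\Lambda)$ if $\Delta\neq0$ and $2L_\Lambda\le r$, and by $(\Lambda-\Delta XB,\ XB,\ L_\Lambda,\ L_B+1)$ otherwise. Put $L_{xB}=L_B+1$. If $L_\Lambda>t$, return nothing. 3. For a polynomial $\Lambda'$ let $I=\{i:\Lambda'(x_i^{-1})=0\}$. Forney's formula gives the error word $E$ with $E_i=-\dfrac{x_i\,\Omega'(x_i^{-1})}{v_i\,(\Lambda')^{\prime}(x_i^{-1})}$ for $i\in I$ and $E_i=0$ otherwise, where $\Omega'=\Lambda'\cdot\sum_{j<n-k}S_jX^j \bmod X^{n-k}$ and $(\Lambda')^{\prime}$ is the derivative of $\Lambda'$. If $L_{xB}>t$: if $|I|=L_\Lambda$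 for $\Lambda'=\Lambda$, return the single word $R-E$ computed from $\Lambda$, and otherwise return nothing. 4. Rational interpolation: let $y_i=-\Lambda(x_i^{-1})/(x_i^{-1}B(x_i^{-1}))$, with $y_i=\infty$ if $B(x_i^{-1})=0$. Choose any nonzero $\mathcal Q(X,Y)$ of $Y$-degree at most $P_y$ that passes through all points $(x_i^{-1},y_i)$ with multiplicity $m$ and has the smallest $(1,L_\Lambda-L_{xB})$-weighted degree among all such polynomials. (Passing through $(a,b)$ with multiplicity $m$ means that $\mathcal Q(a+X,b+Y)$ has no monomial of total degree less than $m$; passing through $(a,\infty)$ means that $Y^{P_y}\mathcal Q(X,1/Y)$ passes so through $(a,0)$.) 5. Rational factorization: put $\mathcal Q^{(0)}=\mathcal Q$. For $i=0,1,\dots$ and for each root $s_i\in F$ of $\mathcal Q^{(i)}(0,Y)$, let $\mathcal Q^{(i+1)}$ be $\mathcal Q^{(i)}(X,s_i+XY)$ divided by the largest power of $X$ that divides it. Collect all truncated series $s=s_0+\dots+s_{L_s-1}X^{L_s-1}$ that arise, where $L_s=(t-L_{xB}+1)+2(t-L_\Lambda)$. 6. For each $s$, let $\lambda$ be the polynomial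 "$\Lambda$" that the Berlekamp–Massey algorithm computes from the $2(t-L_\Lambda)$ terms $s_{t-L_{xB}+1},s_{t-L_{xB}+2},\dots$, let $b=s\lambda\bmod X^{t-L_{xB}+1}$ and $\Lambda'=\lambda\Lambda+b\,XB$. If the number of $i$ with $\Lambda'(x_i^{-1})=0$ equals $\deg\Lambda'$, compute $R-E$ by Forney's formula from $\Lambda'$. Return all results that are codewords within Hamming distance $t$ of $R$. Then for every $R\in F^n$ the algorithm has an output (a polynomial $\mathcal Q$ as in step 4 exists whenever step 4 is reached), and for every choice of $\mathcal Q$ the set of words returned is exactly the set of codewords of $\mathcal C$ within Hamming distance $t$ of $R$. Hence the algorithm list-decodes up to any $t$ (with $2t\neq d$) below the Johnson radius $n(1-\sqrt{1-D})$, $D=d/n$. -/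

import Mathlib

open Polynomial

noncomputable section

namespace WuListDecoding

variable {F : Type*} [Field F]

/-! ## Reed-Solomon codes and generalized Reed-Solomon codes -/

/-- The generator polynomial `G(x) = ∏_{i < r} (x - α ^ (m₀ + i))`. -/
def rsGenerator (α : F) (m₀ : ℤ) (r : ℕ) : F[X] :=
  ∏ i ∈ Finset.range r, (X - C (α ^ (m₀ + (i : ℤ))))

/-- The polynomial `C₀ + C₁ x + ... + C_{n-1} x^{n-1}` of a word of length `n`. -/
def wordPoly {n : ℕ} (c : Fin n → F) : F[X] :=
  ∑ i : Fin n, C (c i) * X ^ (i : ℕ)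

/-- The (possibly shortened) `(n, k)` Reed-Solomon code: the words whose polynomial is a multiple
of the generator polynomial of degree `n - k`. -/
def rsCode (α : F) (m₀ : ℤ) (n k : ℕ) : Set (Fin n → F) :=
  {c | rsGenerator α m₀ (n - k) ∣ wordPoly c}

/-- The syndromes `S_j = ∑ i, R_i v_i x_i ^ j` of a word `R`, for code locators `x` and column
multipliers `v`. With `x_i = α ^ i` and `v_i = α ^ (m₀ i)` this is `R(α ^ (j + m₀))`. -/
def syndrome {n : ℕ} (x v R : Fin n → F) (j : ℕ) : F :=
  ∑ i : Fin n, R i * v i * x i ^ j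

/-- The `(n, k)` generalized Reed-Solomon code with code locators `x` and column multipliers `v`:
the kernel of the `(n - k) × n` parity-check matrix `(v_i x_i ^ j)`. -/
def grsCode {n : ℕ} (x v : Fin n → F) (k : ℕ) : Set (Fin n → F) :=
  {c | ∀ j < n - k, syndrome x v c j = 0}

/-! ## The Berlekamp-Massey algorithm -/

/-- A state of the Berlekamp-Massey algorithm: the error locator polynomial `Λ`, the correction
polynomial `B`, and the lengths of their shift registers. -/
structure BMState (F : Type*) [Field F] where
  Λ : F[X]
  B : F[X]
  LΛ : ℕ
  LB : ℕ

/-- The length of the shift register of `x B(x)`. -/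
def BMState.LxB (s : BMState F) : ℕ := s.LB + 1

/-- The discrepancy `Δ^(r+1) = ∑_{i=0}^{L_Λ} Λ_i S_{r-i}` (`L_Λ ≤ r` in every reachable state, so
that the subtraction does not truncate). -/
def BMState.discrepancy (s : BMState F) (S : ℕ → F) (r : ℕ) : F :=
  ∑ i ∈ Finset.range (s.LΛ + 1), s.Λ.coeff i * S (r - i)

open Classical in
/-- The iteration of the Berlekamp-Massey algorithm with index `r`. -/
def BMState.step (s : BMState F) (S : ℕ → F) (r : ℕ) : BMState F :=
  let Δ := s.discrepancy S r
  if Δ ≠ 0 ∧ 2 * s.LΛ ≤ r then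
    { Λ := s.Λ - C Δ * (X * s.B), B := C Δ⁻¹ * s.Λ, LΛ := s.LB + 1, LB := s.LΛ }
  else
    { Λ := s.Λ - C Δ * (X * s.B), B := X * s.B, LΛ := s.LΛ, LB := s.LB + 1 }

/-- The Berlekamp-Massey algorithm on the input `S_0, ..., S_{N-1}`. -/
def berlekampMassey (S : ℕ → F) : ℕ → BMState F
  | 0 => { Λ := 1, B := 1, LΛ := 0, LB := 0 }
  | r + 1 => (berlekampMassey S r).step S r

/-! ## Rational interpolation

A bivariate polynomial `Q(x, y)` is an element of `F[X][X]`: the outer variable is `y`, and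
`Q.coeff l` is the polynomial in `x` that multiplies `y ^ l`. -/

/-- The ordinate `y = -Λ(a) / (a B(a))` at the abscissa `a`; `none` is the point at infinity. -/
def ordinate (s : BMState F) (a : F) : Option F :=
  open Classical in
  if s.B.eval a = 0 then none else some (-(s.Λ.eval a) / (a * s.B.eval a))

/-- The polynomial `Q(a + x, b + y)`. -/
def shiftXY (a b : F) (Q : F[X][X]) : F[X][X] :=
  (Q.map (compRingHom (X + C a))).comp (X + C (C b))

/-- `Q` passes through the finite point `(a, b)` with multiplicity (at least) `m`: the polynomial
`Q(a + x, b + y)` has no monomial of total degree less than `m`. -/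
def PassesFin (Q : F[X][X]) (a b : F) (m : ℕ) : Prop :=
  ∀ i j, i + j < m → ((shiftXY a b Q).coeff j).coeff i = 0

/-- The companion polynomial `Q(x, 1/y) y ^ P = ∑_{l ≤ P} f_{P - l}(x) y ^ l` of the polynomial
`Q = ∑_{l ≤ P} f_l(x) y ^ l`. -/
def companion (P : ℕ) (Q : F[X][X]) : F[X][X] :=
  ∑ l ∈ Finset.range (P + 1), C (Q.coeff (P - l)) * X ^ l

/-- `Q` passes through a point `(a, b)`, where `b` may be infinite, with multiplicity `m`. At
`(a, ∞)` this means that the companion polynomial passes through `(a, 0)`. -/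
def Passes (P : ℕ) (Q : F[X][X]) (a : F) (m : ℕ) : Option F → Prop
  | some b => PassesFin Q a b m
  | none => PassesFin (companion P Q) a 0 m

/-- The `(1, w)`-weighted degree of `Q`: the maximum of `i + w j` over the monomials `x ^ i y ^ j`
of `Q`. The weight `w` may be negative. -/
def wdeg (w : ℤ) (Q : F[X][X]) : WithBot ℤ :=
  Q.support.sup fun j => (Q.coeff j).support.sup fun i => (((i : ℤ) + w * (j : ℤ) : ℤ) : WithBot ℤ)

/-- `Q` is a nonzero polynomial of `y`-degree at most `P` that passes through all the points
`(pt i, y_i)` with multiplicity `m`. -/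
structure IsInterpolant {n : ℕ} (pt : Fin n → F) (y : Fin n → Option F) (P m : ℕ)
    (Q : F[X][X]) : Prop where
  ne_zero : Q ≠ 0
  natDegree_le : Q.natDegree ≤ P
  passes : ∀ i, Passes P Q (pt i) m (y i)

/-- The possible results of the rational interpolation: an interpolant of minimum
`(1, w)`-weighted degree. -/
structure IsMinInterpolant {n : ℕ} (pt : Fin n → F) (y : Fin n → Option F) (P m : ℕ) (w : ℤ)
    (Q : F[X][X]) : Prop extends IsInterpolant pt y P m Q where
  minimal : ∀ Q', IsInterpolant pt y P m Q' → wdeg w Q ≤ wdeg w Q'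

/-! ## Rational factorization -/

/-- The exponent of the largest power of `x` that divides `Q(x, y)`, for `Q ≠ 0`. -/
def xOrder (Q : F[X][X]) : ℕ := sInf {a | ∃ j, (Q.coeff j).coeff a ≠ 0}

/-- `Q(x, y) / x ^ a`, where `x ^ a` is the largest power of `x` that divides `Q(x, y)`. -/
def removeX (Q : F[X][X]) : F[X][X] :=
  ∑ j ∈ Finset.range (Q.natDegree + 1), C (Q.coeff j /ₘ X ^ xOrder Q) * X ^ j

/-- From `Q^(i)` and a root `s` of `Q^(i)(0, y)` to `Q^(i+1)`: form `Q^(i)(x, s + y)`, substitute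
`x y` for `y`, and remove the factors `x`. -/
def nextQ (Q : F[X][X]) (s : F) : F[X][X] :=
  removeX ((Q.comp (X + C (C s))).comp (C X * X))

open Classical in
/-- The rational factorization procedure, run for `L` rounds: the finite set of the polynomials
`s_0 + s_1 x + ... + s_{L-1} x ^ (L-1)` where each `s_i` is a root of the polynomial `Q^(i)(0, y)`
obtained from the preceding roots. -/
def rationalFactorization [Fintype F] : ℕ → F[X][X] → Finset F[X]
  | 0, _ => {0}
  | L + 1, Q =>
      (Finset.univ.filter fun s : F => (Q.map (evalRingHom 0)).eval s = 0).biUnion fun s =>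
        (rationalFactorization L (nextQ Q s)).image fun p => C s + X * p

/-! ## The list decoding algorithm -/

open Classical in
/-- The positions `i` such that `x_i⁻¹` is a root of `Λ'` (the valid roots of `Λ'`). -/
def rootPositions {n : ℕ} (x : Fin n → F) (Λ' : F[X]) : Finset (Fin n) :=
  Finset.univ.filter fun i => Λ'.eval (x i)⁻¹ = 0

/-- The error evaluator polynomial `Λ'(x) S(x) mod x ^ r`, with `S(x) = ∑_{j < r} S_j x ^ j`. -/
def errorEvaluator (S : ℕ → F) (r : ℕ) (Λ' : F[X]) : F[X] :=
  (Λ' * ∑ j ∈ Finset.range r, C (S j) * X ^ j) %ₘ X ^ r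

open Classical in
/-- Forney's formula: the error word with the error positions given by the valid roots of `Λ'`. -/
def forney {n : ℕ} (x v : Fin n → F) (k : ℕ) (S : ℕ → F) (Λ' : F[X]) : Fin n → F := fun i =>
  if i ∈ rootPositions x Λ' then
    -(x i * (errorEvaluator S (n - k) Λ').eval (x i)⁻¹) / (v i * (derivative Λ').eval (x i)⁻¹)
  else 0

/-- The polynomial `λ` computed from a finite power series `s`, by the Berlekamp-Massey algorithm
that starts from `s_{t - L_{xB} + 1}` and iterates `2 (t - L_Λ)` times. -/
def lambdaOf (st : BMState F) (t : ℕ) (s : F[X]) : F[X] :=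
  (berlekampMassey (fun l => s.coeff (t - st.LxB + 1 + l)) (2 * (t - st.LΛ))).Λ

/-- The polynomial `b = s λ mod x ^ (t - L_{xB} + 1)`. -/
def bOf (st : BMState F) (t : ℕ) (s : F[X]) : F[X] :=
  (s * lambdaOf st t s) %ₘ X ^ (t - st.LxB + 1)

/-- The candidate error locator polynomial `Λ' = λ Λ + b x B`. -/
def candidateLocator (st : BMState F) (t : ℕ) (s : F[X]) : F[X] :=
  lambdaOf st t s * st.Λ + bOf st t s * (X * st.B)

/-- The result of the Berlekamp-Massey algorithm on the syndromes of the received word `R`. -/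
def bmOutput {n : ℕ} (x v : Fin n → F) (k : ℕ) (R : Fin n → F) : BMState F :=
  berlekampMassey (syndrome x v R) (n - k)

open Classical in
/-- The words returned after the interpolation step has produced `Q`: factor `Q` up to the length
`L_s = t - L_{xB} + 1 + 2 (t - L_Λ)`; for each power series compute `Λ'`; if the number of its valid
roots is its degree, compute the error word by Forney's formula and correct `R`; return those
results that are codewords within distance `t` of `R`. -/
def decodeWith [Fintype F] [DecidableEq F] {n : ℕ} (x v : Fin n → F) (k t : ℕ) (R : Fin n → F) (Q : F[X][X]) :
    Finset (Fin n → F) :=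
  let st := bmOutput x v k R
  let locators := (rationalFactorization (t - st.LxB + 1 + 2 * (t - st.LΛ)) Q).image
    (candidateLocator st t)
  let valid := locators.filter fun Λ' => (rootPositions x Λ').card = Λ'.natDegree
  (valid.image fun Λ' => R - forney x v k (syndrome x v R) Λ').filter fun c =>
    c ∈ grsCode x v k ∧ hammingDist R c ≤ t

open Classical in
/-- `out` is a possible output of the list decoding algorithm on the received word `R`, for the
generalized Reed-Solomon code with locators `x` and multipliers `v`, the list error correction
capability `t`, the multiplicity `m` and the `y`-degree `P`. The algorithm declares a failure
(returns nothing) if `L_Λ > t`; if `L_{xB} > t`, it returns the word given by `Λ` when `Λ` has `L_Λ`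
valid roots and declares a failure otherwise; in the remaining case it goes through rational
interpolation, whose result `Q` may be any interpolant of minimum weighted degree, and
factorization. -/
def IsOutput [Fintype F] [DecidableEq F] {n : ℕ} (x v : Fin n → F) (k t m P : ℕ) (R : Fin n → F)
    (out : Finset (Fin n → F)) : Prop :=
  let st := bmOutput x v k R
  if t < st.LΛ then out = ∅
  else if t < st.LxB then
    out = if (rootPositions x st.Λ).card = st.LΛ then
        {R - forney x v k (syndrome x v R) st.Λ} else ∅
  else
    ∃ Q : F[X][X],
      IsMinInterpolant (fun i => (x i)⁻¹) (fun i => ordinate st (x i)⁻¹) P m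
        ((st.LΛ : ℤ) - (st.LxB : ℤ)) Q ∧
      out = decodeWith x v k t R Q

end WuListDecoding

/-- The multiplicity `⌊2 (t - t₀) (n - t) / (t² - 2 n (t - t₀)) + 1⌋`, with `t₀ = d / 2`. -/
def WuListDecoding.multiplicity (n d t : ℕ) : ℕ :=
  ⌊2 * ((t : ℚ) - (d : ℚ) / 2) * ((n : ℚ) - t) / ((t : ℚ) ^ 2 - 2 * n * ((t : ℚ) - (d : ℚ) / 2))
    + 1⌋₊

/-- The `y`-degree `⌊t m / (2 t - 2 t₀)⌋`, with `2 t₀ = d`. -/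
def WuListDecoding.yDegree (d t m : ℕ) : ℕ :=
  ⌊(t : ℚ) * m / (2 * (t : ℚ) - d)⌋₊

end

/-! The pairs (Λ, Ω) and (XB, Φ) maintained by Berlekamp–Massey have determinant -X^r
(`BMState.Invariant.determinant`). Cramer's rule therefore writes the locator of any error pattern
of weight e with the given syndromes as l Λ + b XB, where l(0) = 1, l and b are coprime, deg l ≤ e -
L_Λ, and either b = 0 or deg b ≤ e - L_{xB} (`exists_errorLocator_eq`). If L_Λ > t, no pattern of
weight at most t exists; if L_{xB} > t, then b = 0 and the locator is Λ itself.

In the remaining case b/l takes the value y_i at every error position, with a pole where y_i = ∞.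
Hence the polynomial l^P Q(x, b/l) has zeros of multiplicity m at e distinct points. A weighted
degree bound on Q gives it degree below em, so it vanishes (`homEval_eq_zero`). Comparing unknowns
with linear conditions yields an interpolant within this bound, which the minimal one then also
meets; the choice of m and P makes the count work exactly because n(2t - d) < t², the Johnson
condition (`count_ineq`, `exists_interpolant`).

Since l(0) = 1, b/l is a power series root of Q. Rational factorization finds its truncation, and
L_s terms determine l and b (`lambdaOf_eq_and_bOf_eq`), hence the locator and, by Forney, the error.
Spurious candidates are removed by the final check of membership and distance. -/

namespace WuListDecoding

/-! ### Berlekamp–Massey as a basis of solutions of the key equation. -/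

section BerlekampMassey

variable {F : Type*} [Field F]

/-- The state `s` solves the key equation for the polynomial `S` modulo `X ^ r`, with evaluators
`Ω` of `Λ` and `Φ` of `X B`. -/
structure BMState.Invariant (s : BMState F) (S Ω Φ : F[X]) (r : ℕ) : Prop where
  length_add : s.LΛ + s.LB = r
  coeff_zero : s.Λ.coeff 0 = 1
  natDegree_Λ : s.Λ.natDegree ≤ s.LΛ
  natDegree_B : s.B.natDegree ≤ s.LB
  degree_Ω : Ω.degree < (s.LΛ : ℕ)
  degree_Φ : Φ.degree < ((s.LB + 1 : ℕ) : WithBot ℕ)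
  key_Λ : X ^ r ∣ s.Λ * S - Ω
  key_B : X ^ (r + 1) ∣ X * s.B * S - Φ - X ^ r

theorem BMState.Invariant.discrepancy_eq {s : BMState F} {S Ω Φ : F[X]} {r : ℕ}
    (h : s.Invariant S Ω Φ r) {f : ℕ → F} (hf : ∀ j ≤ r, S.coeff j = f j) :
    s.discrepancy f r = (s.Λ * S).coeff r := by
  have hle : s.LΛ ≤ r := by have := h.length_add; omega
  rw [coeff_mul, Finset.Nat.sum_antidiagonal_eq_sum_range_succ
    (fun i j => s.Λ.coeff i * S.coeff j), BMState.discrepancy]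
  refine Finset.sum_subset_zero_on_sdiff (Finset.range_mono (by omega)) ?_ ?_
  · intro i hi
    rw [Finset.mem_sdiff, Finset.mem_range, Finset.mem_range] at hi
    rw [coeff_eq_zero_of_natDegree_lt (by have := h.natDegree_Λ; omega), zero_mul]
  · intro i hi
    rw [hf _ (Nat.sub_le _ _)]

theorem BMState.Invariant.discrepancy_dvd {s : BMState F} {S Ω Φ : F[X]} {r : ℕ}
    (h : s.Invariant S Ω Φ r) {f : ℕ → F} (hf : ∀ j ≤ r, S.coeff j = f j) :
    X ^ (r + 1) ∣ s.Λ * S - Ω - C (s.discrepancy f r) * X ^ r := by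
  rw [h.discrepancy_eq hf]
  have hle : s.LΛ ≤ r := by have := h.length_add; omega
  have hΩ : Ω.coeff r = 0 := coeff_eq_zero_of_degree_lt
    (h.degree_Ω.trans_le (by exact_mod_cast hle))
  rw [X_pow_dvd_iff]
  intro j hj
  rcases (Nat.lt_succ_iff_lt_or_eq.mp hj) with hj | rfl
  · have := X_pow_dvd_iff.mp h.key_Λ j hj
    rw [coeff_sub, this, coeff_C_mul, coeff_X_pow, if_neg hj.ne, mul_zero, sub_zero]
  · rw [coeff_sub, coeff_sub, hΩ, coeff_C_mul, coeff_X_pow, if_pos rfl]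
    ring

theorem BMState.Invariant.step {s : BMState F} {S Ω Φ : F[X]} {r : ℕ}
    (h : s.Invariant S Ω Φ r) {f : ℕ → F} (hf : ∀ j ≤ r, S.coeff j = f j) :
    ∃ Ω' Φ', (s.step f r).Invariant S Ω' Φ' (r + 1) := by
  obtain ⟨p, hp⟩ := h.discrepancy_dvd hf
  obtain ⟨q, hq⟩ := h.key_B
  have hlen := h.length_add
  have hXB : (X * s.B).natDegree ≤ s.LB + 1 := by
    refine natDegree_mul_le.trans ?_
    rw [natDegree_X]; have := h.natDegree_B; omega
  have hCXB : ∀ c : F, (C c * (X * s.B)).natDegree ≤ s.LB + 1 := fun c =>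
    (natDegree_C_mul_le _ _).trans hXB
  have hC : ∀ (c : F) (p : F[X]) (N : ℕ), p.degree < N → (C c * p).degree < (N : ℕ) := by
    intro c p N hpN
    rw [degree_lt_iff_coeff_zero] at hpN ⊢
    intro j hj
    rw [coeff_C_mul, hpN j hj, mul_zero]
  have hX : ∀ (p : F[X]) (N : ℕ), p.degree < N → (X * p).degree < ((N + 1 : ℕ) : WithBot ℕ) := by
    intro p N hpN
    rw [degree_lt_iff_coeff_zero] at hpN ⊢
    intro j hj
    obtain ⟨j, rfl⟩ : ∃ i, j = i + 1 := ⟨j - 1, by omega⟩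
    rw [coeff_X_mul, hpN j (by omega)]
  have hmono : ∀ (p : F[X]) (N N' : ℕ), N ≤ N' → p.degree < N → p.degree < (N' : ℕ) :=
    fun p N N' hN hp => hp.trans_le (by exact_mod_cast hN)
  have h0 : ∀ c : F, (s.Λ - C c * (X * s.B)).coeff 0 = 1 := fun c => by simp [h.coeff_zero]
  have hkey : X ^ (r + 1) ∣ (s.Λ - C (s.discrepancy f r) * (X * s.B)) * S -
      (Ω - C (s.discrepancy f r) * Φ) :=
    ⟨p - C (s.discrepancy f r) * q, by linear_combination hp - C (s.discrepancy f r) * hq⟩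
  unfold BMState.step
  by_cases hc : s.discrepancy f r ≠ 0 ∧ 2 * s.LΛ ≤ r
  -- Multiplying Λ S ≡ Ω + Δ X^r by Δ⁻¹ X shows that the old Λ, rescaled, is the new B, with the
  -- coefficient of X^(r+1) normalized to 1.
  · refine ⟨Ω - C (s.discrepancy f r) * Φ, C (s.discrepancy f r)⁻¹ * (X * Ω), ?_⟩
    simp only [if_pos hc]
    have hone : C (s.discrepancy f r)⁻¹ * C (s.discrepancy f r) = 1 := by
      rw [← C_mul, inv_mul_cancel₀ hc.1, C_1]
    refine ⟨by dsimp only; omega, h0 _, ?_, ?_, ?_, ?_, hkey, ?_⟩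
    · refine (natDegree_sub_le _ _).trans (max_le (h.natDegree_Λ.trans ?_) (hCXB _))
      dsimp only; omega
    · exact (natDegree_C_mul_le _ _).trans h.natDegree_Λ
    · exact (degree_sub_le _ _).trans_lt (max_lt (hmono _ _ _ (by dsimp only; omega) h.degree_Ω)
        (hC _ _ _ h.degree_Φ))
    · exact hC _ _ _ (hX _ _ h.degree_Ω)
    · refine ⟨C (s.discrepancy f r)⁻¹ * p, ?_⟩
      linear_combination C (s.discrepancy f r)⁻¹ * X * hp + X ^ (r + 1) * hone
  · refine ⟨Ω - C (s.discrepancy f r) * Φ, X * Φ, ?_⟩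
    simp only [if_neg hc]
    refine ⟨by dsimp only; omega, h0 _, ?_, hXB, ?_, hX _ _ h.degree_Φ, hkey, ?_⟩
    · by_cases hd : s.discrepancy f r = 0
      · simpa [hd] using h.natDegree_Λ
      -- Here r < 2 L_Λ, so L_B + 1 ≤ L_Λ and subtracting Δ X B does not lengthen Λ.
      · have : ¬ 2 * s.LΛ ≤ r := fun h => hc ⟨hd, h⟩
        refine (natDegree_sub_le _ _).trans (max_le h.natDegree_Λ ((hCXB _).trans ?_))
        dsimp only; omega
    · by_cases hd : s.discrepancy f r = 0
      · simpa [hd] using h.degree_Ω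
      · have : ¬ 2 * s.LΛ ≤ r := fun h => hc ⟨hd, h⟩
        exact (degree_sub_le _ _).trans_lt (max_lt h.degree_Ω
          (hmono _ _ _ (by dsimp only; omega) (hC _ _ _ h.degree_Φ)))
    · exact ⟨q, by linear_combination X * hq⟩

theorem berlekampMassey_invariant (S : F[X]) (f : ℕ → F) (r : ℕ)
    (hf : ∀ j < r, S.coeff j = f j) :
    ∃ Ω Φ, (berlekampMassey f r).Invariant S Ω Φ r := by
  induction r with
  | zero =>
    refine ⟨0, -1, rfl, ?_, ?_, ?_, ?_, ?_, ?_, ?_⟩ <;> simp [berlekampMassey]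
  | succ r ih =>
    obtain ⟨Ω, Φ, h⟩ := ih fun j hj => hf j (by omega)
    exact h.step fun j hj => hf j (by omega)

theorem berlekampMassey_length_add (f : ℕ → F) (r : ℕ) :
    (berlekampMassey f r).LΛ + (berlekampMassey f r).LxB = r + 1 := by
  obtain ⟨Ω, Φ, h⟩ := berlekampMassey_invariant
    (∑ j ∈ Finset.range r, C (f j) * X ^ j) f r (by simp +contextual [coeff_X_pow])
  have := h.length_add
  rw [BMState.LxB]; omega

namespace BMState.Invariant

variable {s : BMState F} {S Ω Φ : F[X]} {r : ℕ}

theorem natDegree_X_mul_B (h : s.Invariant S Ω Φ r) : (X * s.B).natDegree ≤ s.LB + 1 := by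
  refine natDegree_mul_le.trans ?_
  rw [natDegree_X]; have := h.natDegree_B; omega

theorem _root_.Polynomial.degree_mul_lt_of_natDegree_le {p q : F[X]} {a b c : ℕ}
    (hp : p.natDegree ≤ a) (hq : q.degree < b) (hc : a + b ≤ c) :
    (p * q).degree < (c : ℕ) := by
  rcases eq_or_ne q 0 with rfl | hq0
  · simp
  rcases eq_or_ne p 0 with rfl | hp0
  · simp
  rw [degree_eq_natDegree hq0, Nat.cast_lt] at hq
  rw [degree_eq_natDegree (mul_ne_zero hp0 hq0), natDegree_mul hp0 hq0, Nat.cast_lt]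
  omega

/-- Eliminating S from the two congruences gives the identity modulo X^(r+1), using Λ(0) = 1. Both
sides have degree at most r because the lengths add up to r, so the congruence is an equality. -/
theorem determinant (h : s.Invariant S Ω Φ r) : s.Λ * Φ - Ω * (X * s.B) = -X ^ r := by
  obtain ⟨p, hp⟩ := h.key_Λ
  obtain ⟨q, hq⟩ := h.key_B
  obtain ⟨g, hg⟩ : X ∣ s.Λ - 1 := X_dvd_iff.mpr (by simp [h.coeff_zero])
  have hlen := h.length_add
  have hdvd : X ^ (r + 1) ∣ s.Λ * Φ - Ω * (X * s.B) + X ^ r :=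
    ⟨-s.Λ * q + s.B * p - g, by linear_combination X * s.B * hp - s.Λ * hq - X ^ r * hg⟩
  have hdeg : (s.Λ * Φ - Ω * (X * s.B) + X ^ r).degree < ((r + 1 : ℕ) : WithBot ℕ) := by
    refine (degree_add_le _ _).trans_lt (max_lt ((degree_sub_le _ _).trans_lt (max_lt ?_ ?_)) ?_)
    · exact degree_mul_lt_of_natDegree_le h.natDegree_Λ h.degree_Φ (by omega)
    · rw [mul_comm]
      exact degree_mul_lt_of_natDegree_le h.natDegree_X_mul_B h.degree_Ω (by omega)
    · rw [degree_X_pow, Nat.cast_lt]; omega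
  have := eq_zero_of_dvd_of_degree_lt hdvd (by rwa [degree_X_pow])
  linear_combination this

theorem eval_Λ_ne_zero (h : s.Invariant S Ω Φ r) {a : F} (ha : a ≠ 0) (hB : s.B.eval a = 0) :
    s.Λ.eval a ≠ 0 := by
  intro hΛ
  have := congrArg (eval a) h.determinant
  simp [hΛ, hB, ha] at this

/-- Every solution of the key equation is a combination of the two solutions of the state. -/
theorem exists_combination (h : s.Invariant S Ω Φ r) {A W : F[X]} {τ : ℕ}
    (hA : A.natDegree ≤ τ) (hW : W.degree < τ) (hAW : X ^ r ∣ A * S - W) :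
    ∃ l b : F[X], A = l * s.Λ + b * (X * s.B) ∧ W = l * Ω + b * Φ ∧
      (l = 0 ∨ l.natDegree + s.LΛ ≤ τ) ∧ (b = 0 ∨ b.natDegree + s.LxB ≤ τ) := by
  obtain ⟨p, hp⟩ := h.key_Λ
  obtain ⟨q, hq⟩ := h.key_B
  obtain ⟨g, hg⟩ := hAW
  have hdet := h.determinant
  have hlen := h.length_add
  have hXr : (X : F[X]) ^ r ≠ 0 := pow_ne_zero _ X_ne_zero
  -- Cramer's rule: the numerators of l and b are divisible by the determinant X^r, and the
  -- quotients are read off from the congruences. Their degrees follow from those of the numerators.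
  have hl : X ^ r * (A + A * X * q - X * s.B * g) = (X * s.B) * W - A * Φ := by
    linear_combination (X * s.B) * hg - A * hq
  have hb : X ^ r * (s.Λ * g - A * p) = A * Ω - s.Λ * W := by
    linear_combination A * hp - s.Λ * hg
  have hdegree : ∀ (u v : F[X]) (c : ℕ), X ^ r * u = v → v.degree < c →
      u = 0 ∨ r + u.natDegree < c := by
    intro u v c huv hv
    refine or_iff_not_imp_left.mpr fun hu => ?_
    rwa [← huv, degree_eq_natDegree (mul_ne_zero hXr hu), natDegree_mul hXr hu, natDegree_X_pow,
      Nat.cast_lt] at hv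
  refine ⟨A + A * X * q - X * s.B * g, s.Λ * g - A * p, ?_, ?_, ?_, ?_⟩
  · apply mul_left_cancel₀ hXr
    linear_combination -s.Λ * hl - (X * s.B) * hb + A * hdet
  · apply mul_left_cancel₀ hXr
    linear_combination -Ω * hl - Φ * hb + W * hdet
  · refine (hdegree _ _ (τ + s.LB + 1) hl ((degree_sub_le _ _).trans_lt (max_lt ?_ ?_))).imp_right
      fun _ => by omega
    · exact degree_mul_lt_of_natDegree_le h.natDegree_X_mul_B hW (by omega)
    · exact degree_mul_lt_of_natDegree_le hA h.degree_Φ (by omega)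
  · refine (hdegree _ _ (τ + s.LΛ) hb ((degree_sub_le _ _).trans_lt (max_lt ?_ ?_))).imp_right
      fun _ => by rw [LxB]; omega
    · exact degree_mul_lt_of_natDegree_le hA h.degree_Ω (by omega)
    · exact degree_mul_lt_of_natDegree_le h.natDegree_Λ hW (by omega)

/-- A normalized coprime solution of the key equation, with its expression in terms of the state. -/
theorem exists_coprime_combination (h : s.Invariant S Ω Φ r) {A W : F[X]} {τ : ℕ}
    (hA : A.natDegree ≤ τ) (hW : W.degree < τ) (hAW : X ^ r ∣ A * S - W)
    (hA0 : A.coeff 0 = 1) (hcop : IsCoprime A W) :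
    ∃ l b : F[X], A = l * s.Λ + b * (X * s.B) ∧ l.coeff 0 = 1 ∧ IsCoprime l b ∧
      l.natDegree + s.LΛ ≤ τ ∧ (b = 0 ∨ b.natDegree + s.LxB ≤ τ) ∧ (b = 0 → A = s.Λ) := by
  obtain ⟨l, b, h1, h2, h3, h4⟩ := h.exists_combination hA hW hAW
  have hl0 : l.coeff 0 = 1 := by
    have := congrArg (fun p => coeff p 0) h1
    simpa [hA0, h.coeff_zero] using this.symm
  -- A common factor of l and b would divide both A and W.
  have hlb : IsCoprime l b := by
    obtain ⟨u, v, huv⟩ := hcop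
    refine ⟨u * s.Λ + v * Ω, u * (X * s.B) + v * Φ, ?_⟩
    linear_combination huv - u * h1 - v * h2
  refine ⟨l, b, h1, hl0, hlb, h3.resolve_left ?_, h4, ?_⟩
  · rintro rfl; simp at hl0
  · rintro rfl
    obtain ⟨c, -, hc⟩ := Polynomial.isUnit_iff.mp (isCoprime_zero_right.mp hlb)
    rw [← hc, coeff_C_zero] at hl0
    rw [h1, ← hc, hl0]; simp

end BMState.Invariant

end BerlekampMassey

/-! ### Error locators, error evaluators and Forney's formula. -/

section ErrorLocator

variable {F : Type*} [Field F] {n : ℕ}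

/-- The error locator polynomial of a set of positions. -/
noncomputable def errorLocator (x : Fin n → F) (E : Finset (Fin n)) : F[X] :=
  ∏ i ∈ E, (1 - C (x i) * X)

/-- The error evaluator polynomial of a set of positions with weights. -/
noncomputable def locatorEvaluator (x w : Fin n → F) (E : Finset (Fin n)) : F[X] :=
  ∑ i ∈ E, C (w i) * ∏ j ∈ E.erase i, (1 - C (x j) * X)

/-- The polynomial of the first `N` terms of a sequence. -/
noncomputable def seqPoly (S : ℕ → F) (N : ℕ) : F[X] :=
  ∑ j ∈ Finset.range N, C (S j) * X ^ j

theorem coeff_seqPoly (S : ℕ → F) {N j : ℕ} (hj : j < N) : (seqPoly S N).coeff j = S j := by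
  simp +contextual [seqPoly, coeff_X_pow, hj]

theorem seqPoly_congr {S T : ℕ → F} {N : ℕ} (h : ∀ j < N, S j = T j) :
    seqPoly S N = seqPoly T N :=
  Finset.sum_congr rfl fun j hj => by rw [h j (Finset.mem_range.mp hj)]

variable {x : Fin n → F}

theorem coeff_zero_errorLocator (x : Fin n → F) (E : Finset (Fin n)) :
    (errorLocator x E).coeff 0 = 1 := by
  rw [coeff_zero_eq_eval_zero, errorLocator, eval_prod]
  simp

theorem natDegree_errorLocator_le (x : Fin n → F) (E : Finset (Fin n)) :
    (errorLocator x E).natDegree ≤ E.card := by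
  refine (natDegree_prod_le _ _).trans ?_
  rw [Finset.card_eq_sum_ones]
  refine Finset.sum_le_sum fun i _ => ?_
  compute_degree

theorem eval_errorLocator (x : Fin n → F) (E : Finset (Fin n)) (a : F) :
    (errorLocator x E).eval a = ∏ i ∈ E, (1 - x i * a) := by
  simp [errorLocator, eval_prod]

theorem one_sub_mul_inv_ne_zero (hx : Function.Injective x) (h0 : ∀ i, x i ≠ 0) {i j : Fin n}
    (hij : i ≠ j) : 1 - x i * (x j)⁻¹ ≠ 0 := by
  intro h
  apply hij
  apply hx
  have := h0 j
  field_simp at h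
  linear_combination -h

theorem mem_rootPositions {x : Fin n → F} {A : F[X]} {i : Fin n} :
    i ∈ rootPositions x A ↔ A.eval (x i)⁻¹ = 0 := by
  simp [rootPositions]

theorem rootPositions_errorLocator (hx : Function.Injective x) (h0 : ∀ i, x i ≠ 0)
    (E : Finset (Fin n)) : rootPositions x (errorLocator x E) = E := by
  ext j
  rw [mem_rootPositions, eval_errorLocator, Finset.prod_eq_zero_iff]
  constructor
  · rintro ⟨i, hi, hij⟩
    by_contra hj
    exact one_sub_mul_inv_ne_zero hx h0 (fun h : i = j => hj (h ▸ hi)) hij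
  · exact fun hj => ⟨j, hj, by rw [mul_inv_cancel₀ (h0 j), sub_self]⟩

theorem natDegree_errorLocator (h0 : ∀ i, x i ≠ 0) (E : Finset (Fin n)) :
    (errorLocator x E).natDegree = E.card := by
  have hne : ∀ i, (1 - C (x i) * X : F[X]).natDegree = 1 := fun i => by
    have : (1 - C (x i) * X : F[X]) = C (-x i) * X + C 1 := by simp; ring
    rw [this, natDegree_linear (neg_ne_zero.mpr (h0 i))]
  rw [errorLocator, natDegree_prod _ _ fun i _ h => by simpa [h] using hne i,
    Finset.sum_congr rfl fun i _ => hne i, Finset.card_eq_sum_ones]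

theorem eval_derivative_errorLocator (h0 : ∀ i, x i ≠ 0) {E : Finset (Fin n)} {i : Fin n}
    (hi : i ∈ E) : (derivative (errorLocator x E)).eval (x i)⁻¹ =
      -x i * ∏ j ∈ E.erase i, (1 - x j * (x i)⁻¹) := by
  rw [errorLocator, ← Finset.mul_prod_erase _ _ hi, derivative_mul, eval_add, eval_mul, eval_mul]
  simp [eval_prod, h0 i]

theorem eval_locatorEvaluator (h0 : ∀ i, x i ≠ 0) (w : Fin n → F) {E : Finset (Fin n)} {i : Fin n}
    (hi : i ∈ E) : (locatorEvaluator x w E).eval (x i)⁻¹ =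
      w i * ∏ j ∈ E.erase i, (1 - x j * (x i)⁻¹) := by
  rw [locatorEvaluator, eval_finsetSum, Finset.sum_eq_single i]
  · simp [eval_prod]
  · intro j _ hji
    rw [eval_mul, eval_prod, Finset.prod_eq_zero (Finset.mem_erase.mpr ⟨hji.symm, hi⟩), mul_zero]
    simp [h0 i]
  · exact fun h => (h hi).elim

theorem degree_locatorEvaluator_lt (x w : Fin n → F) (E : Finset (Fin n)) :
    (locatorEvaluator x w E).degree < E.card := by
  refine (degree_sum_le _ _).trans_lt ((Finset.sup_lt_iff (WithBot.bot_lt_coe _)).mpr ?_)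
  intro i hi
  refine degree_le_natDegree.trans_lt ?_
  have h0 := natDegree_C_mul_le (w i) (errorLocator x (E.erase i))
  have h1 := natDegree_errorLocator_le x (E.erase i)
  have h2 := Finset.card_erase_lt_of_mem hi
  exact_mod_cast (h0.trans h1).trans_lt h2

/-- The syndrome polynomial is a sum of truncated geometric series with ratios x_i X. The factor 1 -
x_i X of the locator telescopes the i-th one, up to a multiple of X^N. -/
theorem errorLocator_key (x v e : Fin n → F) (E : Finset (Fin n)) (he : ∀ i ∉ E, e i = 0) (N : ℕ) :
    X ^ N ∣ errorLocator x E * seqPoly (syndrome x v e) N -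
      locatorEvaluator x (fun i => e i * v i) E := by
  have hS : seqPoly (syndrome x v e) N =
      ∑ i ∈ E, C (e i * v i) * ∑ j ∈ Finset.range N, (C (x i) * X) ^ j := by
    simp only [seqPoly, syndrome, map_sum, Finset.sum_mul, Finset.mul_sum]
    rw [Finset.sum_comm]
    symm
    refine Finset.sum_subset_zero_on_sdiff (Finset.subset_univ E) ?_ ?_
    · intro i hi
      rw [Finset.mem_sdiff] at hi
      simp [he i hi.2]
    · intro i _
      refine Finset.sum_congr rfl fun j _ => ?_
      simp only [map_mul, map_pow]
      ring
  rw [hS, locatorEvaluator, Finset.mul_sum, ← Finset.sum_sub_distrib]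
  refine Finset.dvd_sum fun i hi => ?_
  have hg := mul_neg_geom_sum (C (x i) * X : F[X]) N
  rw [errorLocator, ← Finset.mul_prod_erase _ _ hi]
  refine ⟨-(C (e i * v i) * C (x i) ^ N * ∏ j ∈ E.erase i, (1 - C (x j) * X)), ?_⟩
  linear_combination (C (e i * v i) * ∏ j ∈ E.erase i, (1 - C (x j) * X)) * hg

theorem isCoprime_errorLocator {E : Finset (Fin n)} {p : F[X]} (h0 : ∀ i, x i ≠ 0)
    (hp : ∀ i ∈ E, p.eval (x i)⁻¹ ≠ 0) : IsCoprime (errorLocator x E) p := by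
  refine IsCoprime.prod_left fun i hi => ?_
  have h : (1 - C (x i) * X : F[X]) = C (-x i) * (X - C (x i)⁻¹) := by
    rw [mul_sub, ← C_mul, neg_mul, mul_inv_cancel₀ (h0 i)]; simp; ring
  rw [h, isCoprime_mul_unit_left_left (by simpa using h0 i)]
  refine ((irreducible_X_sub_C _).coprime_iff_not_dvd).mpr fun hd => hp i hi ?_
  exact dvd_iff_isRoot.mp hd

theorem isCoprime_errorLocator_locatorEvaluator (hx : Function.Injective x) (h0 : ∀ i, x i ≠ 0)
    {w : Fin n → F} {E : Finset (Fin n)} (hw : ∀ i ∈ E, w i ≠ 0) :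
    IsCoprime (errorLocator x E) (locatorEvaluator x w E) := by
  refine isCoprime_errorLocator h0 fun i hi => ?_
  rw [eval_locatorEvaluator h0 w hi]
  refine mul_ne_zero (hw i hi) (Finset.prod_ne_zero_iff.mpr fun j hj => ?_)
  exact one_sub_mul_inv_ne_zero hx h0 (Finset.ne_of_mem_erase hj)

theorem errorEvaluator_eq {S : ℕ → F} {N : ℕ} {A W : F[X]} (h : X ^ N ∣ A * seqPoly S N - W)
    (hW : W.degree < N) : errorEvaluator S N A = W := by
  obtain ⟨g, hg⟩ := h
  have := div_modByMonic_unique (f := A * seqPoly S N) (g := X ^ N) g W (monic_X_pow N)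
    ⟨by linear_combination -hg, by rwa [degree_X_pow]⟩
  exact this.2

/-- At x_i⁻¹ the evaluator and the derivative of the locator contain the same nonzero product over
the other error positions, which cancels in the quotient. -/
theorem forney_errorLocator (hx : Function.Injective x) (h0 : ∀ i, x i ≠ 0) {v : Fin n → F}
    (hv : ∀ i, v i ≠ 0) {e : Fin n → F} {E : Finset (Fin n)} (he : ∀ i ∉ E, e i = 0) {k : ℕ}
    (hE : E.card ≤ n - k) {S : ℕ → F} (hS : ∀ j < n - k, S j = syndrome x v e j) :
    forney x v k S (errorLocator x E) = e := by
  funext i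
  rw [forney, rootPositions_errorLocator hx h0]
  split_ifs with hi
  · have hkey := errorLocator_key x v e E he (n - k)
    rw [← seqPoly_congr hS] at hkey
    rw [errorEvaluator_eq hkey ((degree_locatorEvaluator_lt _ _ _).trans_le (by exact_mod_cast hE)),
      eval_locatorEvaluator h0 _ hi, eval_derivative_errorLocator h0 hi]
    have hp : ∏ j ∈ E.erase i, (1 - x j * (x i)⁻¹) ≠ 0 := Finset.prod_ne_zero_iff.mpr fun j hj =>
      one_sub_mul_inv_ne_zero hx h0 (Finset.ne_of_mem_erase hj)
    have := hv i
    have := h0 i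
    generalize ∏ j ∈ E.erase i, (1 - x j * (x i)⁻¹) = p at hp
    field_simp
  · exact (he i hi).symm

/-- The constant term 1 supplies one further condition besides the L roots: after removing it and
dividing by X, two polynomials of degree below L agree at L points. -/
theorem eq_errorLocator (hx : Function.Injective x) (h0 : ∀ i, x i ≠ 0) {A : F[X]} {L : ℕ}
    (hA : A.natDegree ≤ L) (hA0 : A.coeff 0 = 1) (hL : (rootPositions x A).card = L) :
    A = errorLocator x (rootPositions x A) := by
  have hdeg : ∀ p : F[X], p.natDegree ≤ L → p.coeff 0 = 1 → p.divX.degree < L := by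
    intro p hp hp0
    refine (degree_divX_lt (by rintro rfl; simp at hp0)).trans_le ?_
    exact degree_le_natDegree.trans (by exact_mod_cast hp)
  have heval : ∀ (p : F[X]) (i : Fin n), p.coeff 0 = 1 → p.eval (x i)⁻¹ = 0 →
      p.divX.eval (x i)⁻¹ = - x i := by
    intro p i hp0 hp
    have h := congrArg (eval (x i)⁻¹) (divX_mul_X_add p)
    rw [hp, hp0, eval_add, eval_mul, eval_X, eval_C] at h
    linear_combination x i * h - p.divX.eval (x i)⁻¹ * mul_inv_cancel₀ (h0 i)
  have hloc0 := coeff_zero_errorLocator x (rootPositions x A)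
  have hdiv : A.divX = (errorLocator x (rootPositions x A)).divX := by
    refine eq_of_degrees_lt_of_eval_index_eq (rootPositions x A) (v := fun i => (x i)⁻¹)
      (fun i _ j _ h => hx (inv_injective h)) ?_ ?_ ?_
    · rw [hL]; exact hdeg A hA hA0
    · rw [hL]; exact hdeg _ (hL ▸ natDegree_errorLocator_le _ _) hloc0
    · intro i hi
      have hi' := hi
      rw [← rootPositions_errorLocator hx h0 (rootPositions x A)] at hi'
      rw [heval A i hA0 (mem_rootPositions.mp hi), heval _ i hloc0 (mem_rootPositions.mp hi')]
  calc A = A.divX * X + C (A.coeff 0) := (divX_mul_X_add A).symm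
    _ = (errorLocator x (rootPositions x A)).divX * X +
        C ((errorLocator x (rootPositions x A)).coeff 0) := by rw [hdiv, hA0, hloc0]
    _ = errorLocator x (rootPositions x A) := divX_mul_X_add _

/-- Forney's formula for a solution of the key equation that has as many valid roots as its length
gives a word with the prescribed syndromes. -/
theorem syndrome_forney (hx : Function.Injective x) (h0 : ∀ i, x i ≠ 0) {v : Fin n → F}
    (hv : ∀ i, v i ≠ 0) {k : ℕ} {S : ℕ → F} {A W : F[X]} {L : ℕ} (hL : L ≤ n - k)
    (hA : A.natDegree ≤ L) (hA0 : A.coeff 0 = 1) (hcard : (rootPositions x A).card = L)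
    (hkey : X ^ (n - k) ∣ A * seqPoly S (n - k) - W) (hW : W.degree < L) {j : ℕ} (hj : j < n - k) :
    syndrome x v (forney x v k S A) j = S j := by
  have hAE := eq_errorLocator hx h0 hA hA0 hcard
  have hev := errorEvaluator_eq hkey (hW.trans_le (by exact_mod_cast hL))
  set E := rootPositions x A with hE
  -- Forney's values are exactly those for which the two evaluators, both of degree below L, agree
  -- at the L roots.
  have hWE : locatorEvaluator x (fun i => forney x v k S A i * v i) E = W := by
    refine eq_of_degrees_lt_of_eval_index_eq E (v := fun i => (x i)⁻¹)
      (fun i _ j _ h => hx (inv_injective h)) (degree_locatorEvaluator_lt _ _ _)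
      (by rwa [hcard]) ?_
    intro i hi
    rw [eval_locatorEvaluator h0 _ hi, forney, if_pos (hE ▸ hi), hev, hAE,
      eval_derivative_errorLocator h0 hi]
    have hp : ∏ j ∈ E.erase i, (1 - x j * (x i)⁻¹) ≠ 0 := Finset.prod_ne_zero_iff.mpr fun j hj =>
      one_sub_mul_inv_ne_zero hx h0 (Finset.ne_of_mem_erase hj)
    have := hv i
    have := h0 i
    generalize ∏ j ∈ E.erase i, (1 - x j * (x i)⁻¹) = p at hp
    field_simp
  have hkey' := errorLocator_key x v (forney x v k S A) E
    (fun i hi => by rw [forney, if_neg (hE ▸ hi)]) (n - k)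
  rw [hWE, ← hAE] at hkey'
  -- A is invertible modulo X^(n-k), so A and W determine the syndromes.
  have hcop : IsCoprime (X ^ (n - k)) A := by
    refine IsCoprime.pow_left ((irreducible_X.coprime_iff_not_dvd).mpr fun h => ?_)
    rw [X_dvd_iff, hA0] at h
    exact one_ne_zero h
  have hd := (dvd_sub hkey' hkey)
  rw [sub_sub_sub_cancel_right, ← mul_sub] at hd
  have := X_pow_dvd_iff.mp (hcop.dvd_of_dvd_mul_left hd) j hj
  rwa [coeff_sub, coeff_seqPoly _ hj, coeff_seqPoly _ hj, sub_eq_zero] at this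

end ErrorLocator

/-! ### Power series roots of a bivariate polynomial. -/

section RationalFactorization

variable {F : Type*} [Field F]

theorem removeX_mul (Q : F[X][X]) : C (X ^ xOrder Q) * removeX Q = Q := by
  conv_rhs => rw [Q.as_sum_range_C_mul_X_pow]
  rw [removeX, Finset.mul_sum]
  refine Finset.sum_congr rfl fun j _ => ?_
  have hdvd : X ^ xOrder Q ∣ Q.coeff j := X_pow_dvd_iff.mpr fun a ha => by
    by_contra h
    exact Nat.notMem_of_lt_sInf ha ⟨j, h⟩
  have h := modByMonic_add_div (Q.coeff j) (X ^ xOrder Q)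
  rw [(modByMonic_eq_zero_iff_dvd (monic_X_pow _)).mpr hdvd, zero_add] at h
  rw [← mul_assoc, ← C_mul, h]

theorem eval₂_removeX_eq_zero {Q : F[X][X]} {s : PowerSeries F}
    (h : Q.eval₂ coeToPowerSeries.ringHom s = 0) :
    (removeX Q).eval₂ coeToPowerSeries.ringHom s = 0 := by
  rw [← removeX_mul Q, eval₂_mul, eval₂_C] at h
  refine (mul_eq_zero.mp h).resolve_left ?_
  simp

theorem eval₂_nextQ_eq_zero {Q : F[X][X]} {a : F} {s : PowerSeries F}
    (h : Q.eval₂ coeToPowerSeries.ringHom (PowerSeries.X * s + PowerSeries.C a) = 0) :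
    (nextQ Q a).eval₂ coeToPowerSeries.ringHom s = 0 := by
  refine eval₂_removeX_eq_zero ?_
  rw [eval₂_comp, eval₂_comp, ← h]
  simp

theorem eval_map_constantCoeff {Q : F[X][X]} {s : PowerSeries F}
    (h : Q.eval₂ coeToPowerSeries.ringHom s = 0) :
    (Q.map (evalRingHom 0)).eval (PowerSeries.constantCoeff s) = 0 := by
  have h2 := congrArg PowerSeries.constantCoeff h
  rw [hom_eval₂, map_zero] at h2
  have he : evalRingHom (0 : F) = PowerSeries.constantCoeff.comp coeToPowerSeries.ringHom := by
    ext <;> simp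
  rw [eval_map, he, h2]

/-- The rational factorization finds the truncations of all power series roots. -/
theorem trunc_mem_rationalFactorization [Fintype F] (L : ℕ) (Q : F[X][X]) (s : PowerSeries F)
    (h : Q.eval₂ coeToPowerSeries.ringHom s = 0) :
    PowerSeries.trunc L s ∈ rationalFactorization L Q := by
  classical
  induction L generalizing Q s with
  | zero =>
    rw [rationalFactorization, Finset.mem_singleton]
    ext j
    simp
  | succ L ih =>
    rw [rationalFactorization, Finset.mem_biUnion]
    refine ⟨PowerSeries.constantCoeff s, by simpa using eval_map_constantCoeff h, ?_⟩
    have hs := PowerSeries.eq_X_mul_shift_add_const s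
    rw [Finset.mem_image]
    refine ⟨_, ih _ (PowerSeries.mk fun p => PowerSeries.coeff (p + 1) s)
      (eval₂_nextQ_eq_zero (hs ▸ h)), ?_⟩
    ext j
    cases j with
    | zero => simp [PowerSeries.coeff_trunc]
    | succ j => simp [PowerSeries.coeff_trunc, coeff_C_succ]

end RationalFactorization

/-! ### Substituting a rational function, poles included, into an interpolant. -/

section Multiplicity

variable {F : Type*} [Field F]

/-- The homogenization `w ^ P Q(x, u / w)` of a polynomial `Q` of `y`-degree at most `P`. -/
noncomputable def homEval {R : Type*} [CommRing R] (P : ℕ) (Q : R[X]) (u w : R) : R :=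
  ∑ l ∈ Finset.range (P + 1), Q.coeff l * u ^ l * w ^ (P - l)

/-- Here s plays the role of u/w; this serves both in the fraction field and in the power series
ring. -/
theorem map_homEval {R K : Type*} [CommRing R] [CommRing K] (f : R →+* K) {P : ℕ} {Q : R[X]}
    (hQ : Q.natDegree ≤ P) {u w : R} {s : K} (hs : f u = f w * s) :
    f (homEval P Q u w) = f w ^ P * Q.eval₂ f s := by
  rw [homEval, eval₂_eq_sum_range' f (Nat.lt_succ_of_le hQ), map_sum, Finset.mul_sum]
  refine Finset.sum_congr rfl fun l hl => ?_
  have hl : l ≤ P := Nat.lt_succ_iff.mp (Finset.mem_range.mp hl)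
  rw [map_mul, map_mul, map_pow, map_pow, hs, ← pow_mul_pow_sub (f w) hl]
  ring

/-- A pole of u/w is a zero of w/u, so points at infinity reduce to finite ones. -/
theorem homEval_companion (P : ℕ) (Q : F[X][X]) (u w : F[X]) :
    homEval P (companion P Q) w u = homEval P Q u w := by
  have hc : ∀ l ≤ P, (companion P Q).coeff l = Q.coeff (P - l) := fun l hl => by
    simp +contextual [companion, coeff_X_pow, Nat.lt_succ_of_le hl]
  rw [homEval, homEval, ← Finset.sum_range_reflect]
  refine Finset.sum_congr rfl fun l hl => ?_
  have hl : l ≤ P := Nat.lt_succ_iff.mp (Finset.mem_range.mp hl)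
  rw [show P + 1 - 1 - l = P - l by omega, hc _ (Nat.sub_le _ _), Nat.sub_sub_self hl]
  ring

theorem natDegree_companion_le (P : ℕ) (Q : F[X][X]) : (companion P Q).natDegree ≤ P := by
  refine natDegree_sum_le_of_forall_le _ _ fun l hl => ?_
  exact (natDegree_C_mul_X_pow_le _ _).trans (Nat.lt_succ_iff.mp (Finset.mem_range.mp hl))

theorem natDegree_shiftXY_le {P : ℕ} {Q : F[X][X]} (hQ : Q.natDegree ≤ P) (a b : F) :
    (shiftXY a b Q).natDegree ≤ P := by
  refine natDegree_comp_le.trans ?_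
  rw [natDegree_X_add_C, mul_one]
  exact natDegree_map_le.trans hQ

theorem shiftXY_neg_shiftXY (a b : F) (Q : F[X][X]) :
    ((shiftXY a b Q).map (compRingHom (X - C a))).comp (X - C (C b)) = Q := by
  have h : (compRingHom (X - C a)).comp (compRingHom (X + C a)) = RingHom.id F[X] := by
    ext <;> simp
  rw [shiftXY, map_comp, map_map, h, map_id, comp_assoc]
  simp

theorem homEval_shiftXY {P : ℕ} {Q : F[X][X]} (hQ : Q.natDegree ≤ P) (a b : F) (u : F[X])
    {w : F[X]} (hw : w ≠ 0) :
    homEval P ((shiftXY a b Q).map (compRingHom (X - C a))) (u - C b * w) w = homEval P Q u w := by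
  have hinj := IsFractionRing.injective F[X] (FractionRing F[X])
  have hw' : algebraMap F[X] (FractionRing F[X]) w ≠ 0 := fun h => hw (hinj (by simpa using h))
  apply hinj
  have hs : algebraMap F[X] (FractionRing F[X]) (u - C b * w) = algebraMap _ _ w *
      (algebraMap _ _ u / algebraMap _ _ w - algebraMap _ _ (C b)) := by
    rw [map_sub, map_mul]
    field_simp
  rw [map_homEval _ hQ (mul_div_cancel₀ _ hw').symm,
    map_homEval _ (natDegree_map_le.trans (natDegree_shiftXY_le hQ a b)) hs]
  conv_rhs => rw [← shiftXY_neg_shiftXY a b Q, eval₂_comp]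
  simp only [eval₂_sub, eval₂_X, eval₂_C]

/-- A polynomial that passes through `(a, b)` with multiplicity `m` vanishes at `a` with
multiplicity `m` on every rational function with value `b` at `a`. -/
theorem PassesFin.dvd_homEval {P m : ℕ} {Q : F[X][X]} {a b : F} (h : PassesFin Q a b m)
    (hQ : Q.natDegree ≤ P) {u w : F[X]} (hw : w ≠ 0) (hu : u.eval a = b * w.eval a) :
    (X - C a) ^ m ∣ homEval P Q u w := by
  rw [← homEval_shiftXY hQ a b u hw]
  refine Finset.dvd_sum fun j _ => Dvd.dvd.mul_right ?_ _
  have h1 : (X - C a) ^ (m - j) ∣ (((shiftXY a b Q).map (compRingHom (X - C a))).coeff j) := by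
    obtain ⟨g, hg⟩ : X ^ (m - j) ∣ (shiftXY a b Q).coeff j :=
      X_pow_dvd_iff.mpr fun i hi => h i j (by omega)
    rw [coeff_map, hg, map_mul, map_pow]
    exact ⟨g.comp (X - C a), by simp⟩
  have h2 : (X - C a) ^ j ∣ (u - C b * w) ^ j := by
    refine pow_dvd_pow_of_dvd (dvd_iff_isRoot.mpr ?_) j
    simp [hu]
  refine (pow_dvd_pow _ (by omega : m ≤ (m - j) + j)).trans ?_
  rw [pow_add]
  exact mul_dvd_mul h1 h2

theorem natDegree_homEval_le {P : ℕ} {Q : F[X][X]} {u w : F[X]} {D α β : ℤ}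
    (hQ : wdeg (β - α) Q ≤ D) (hw : (w.natDegree : ℤ) ≤ α)
    (hu : u = 0 ∨ (u.natDegree : ℤ) ≤ β) :
    homEval P Q u w = 0 ∨ ((homEval P Q u w).natDegree : ℤ) ≤ D + P * α := by
  by_contra! hcon
  obtain ⟨h0, hlt⟩ := hcon
  have hcoeff := leadingCoeff_ne_zero.mpr h0
  rw [leadingCoeff, homEval, finsetSum_coeff] at hcoeff
  obtain ⟨l, hl, hne⟩ := Finset.exists_ne_zero_of_sum_ne_zero hcoeff
  have hl : l ≤ P := Nat.lt_succ_iff.mp (Finset.mem_range.mp hl)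
  have hle := le_natDegree_of_ne_zero hne
  have hne0 : Q.coeff l * u ^ l * w ^ (P - l) ≠ 0 := fun h => hne (by rw [h, coeff_zero])
  have hQl : Q.coeff l ≠ 0 := left_ne_zero_of_mul (left_ne_zero_of_mul hne0)
  have hul : u ^ l ≠ 0 := right_ne_zero_of_mul (left_ne_zero_of_mul hne0)
  have hwl : w ^ (P - l) ≠ 0 := right_ne_zero_of_mul hne0
  rw [natDegree_mul (mul_ne_zero hQl hul) hwl, natDegree_mul hQl hul, natDegree_pow,
    natDegree_pow] at hle
  have h1 : ((Q.coeff l).natDegree : ℤ) + (β - α) * l ≤ D := by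
    have : (((((Q.coeff l).natDegree : ℤ) + (β - α) * (l : ℤ) : ℤ)) : WithBot ℤ) ≤ D := by
      refine le_trans ?_ hQ
      refine le_trans ?_ (Finset.le_sup (f := fun j => (Q.coeff j).support.sup fun i =>
        (((i : ℤ) + (β - α) * (j : ℤ) : ℤ) : WithBot ℤ)) (mem_support_iff.mpr hQl))
      exact Finset.le_sup (f := fun i : ℕ => (((i : ℤ) + (β - α) * (l : ℤ) : ℤ) : WithBot ℤ))
        (natDegree_mem_support_of_nonzero hQl)
    exact_mod_cast this
  have h2 : (l : ℤ) * u.natDegree ≤ l * β := by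
    -- If u = 0, only the term l = 0 survives, so β is allowed to be negative.
    rcases hu with rfl | hu
    · have : l = 0 := by by_contra h; exact hul (zero_pow h)
      simp [this]
    · exact mul_le_mul_of_nonneg_left hu (by positivity)
  have h3 : ((P : ℤ) - l) * w.natDegree ≤ ((P : ℤ) - l) * α :=
    mul_le_mul_of_nonneg_left hw (by omega)
  have h4 : (((homEval P Q u w).natDegree : ℕ) : ℤ) ≤
      (Q.coeff l).natDegree + l * u.natDegree + ((P : ℤ) - l) * w.natDegree := by
    have := Int.ofNat_le.mpr hle
    push_cast [Nat.cast_sub hl] at this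
    exact this
  nlinarith

theorem eq_zero_of_forall_pow_dvd {n : ℕ} {x : Fin n → F} (hx : Function.Injective x)
    {E : Finset (Fin n)} {m : ℕ} {p : F[X]} (hdvd : ∀ i ∈ E, (X - C (x i)⁻¹) ^ m ∣ p)
    (hp : p = 0 ∨ p.natDegree < E.card * m) : p = 0 := by
  refine hp.elim id fun hp => ?_
  have hprod : ∏ i ∈ E, (X - C (x i)⁻¹) ^ m ∣ p := by
    refine Finset.prod_dvd_of_coprime (fun i _ j _ hij => ?_) hdvd
    exact (pairwise_coprime_X_sub_C (s := fun i => (x i)⁻¹)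
      (fun i j h => hx (inv_injective h)) hij).pow
  by_contra h0
  have := natDegree_le_of_dvd hprod h0
  rw [natDegree_prod _ _ fun i _ => pow_ne_zero _ (X_sub_C_ne_zero _)] at this
  simp at this
  omega

end Multiplicity

/-! ### Existence of interpolants and of minimal ones. -/

section Interpolation

variable {F : Type*} [Field F]

theorem smul_eq_C_C_mul (c : F) (Q : F[X][X]) : c • Q = C (C c) * Q := by
  ext
  simp

/-- The coefficient of `x ^ i y ^ j` in `Q(a + x, b + y)` as a linear form in `Q`. -/
noncomputable def shiftCoeff (a b : F) (i j : ℕ) : F[X][X] →ₗ[F] F where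
  toFun Q := ((shiftXY a b Q).coeff j).coeff i
  map_add' Q R := by simp [shiftXY]
  map_smul' c Q := by
    rw [smul_eq_C_C_mul, shiftXY, Polynomial.map_mul, mul_comp]
    simp [shiftXY]

/-- The companion polynomial as a linear function. -/
noncomputable def companionLinear (P : ℕ) : F[X][X] →ₗ[F] F[X][X] where
  toFun := companion P
  map_add' Q R := by simp [companion, add_mul, Finset.sum_add_distrib]
  map_smul' c Q := by
    rw [smul_eq_C_C_mul, RingHom.id_apply, smul_eq_C_C_mul, companion, companion, Finset.mul_sum]
    refine Finset.sum_congr rfl fun l _ => ?_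
    rw [coeff_C_mul, C_mul, mul_assoc]

/-- The conditions for passing through a point as linear forms. -/
noncomputable def passCoeff (P : ℕ) (a : F) (i j : ℕ) : Option F → (F[X][X] →ₗ[F] F)
  | some b => shiftCoeff a b i j
  | none => (shiftCoeff a 0 i j).comp (companionLinear P)

theorem passes_iff {P m : ℕ} {Q : F[X][X]} {a : F} {y : Option F} :
    Passes P Q a m y ↔ ∀ i j, i + j < m → passCoeff P a i j y Q = 0 := by
  cases y <;> rfl

/-- The bivariate polynomial with given bounded coefficients. -/
noncomputable def ofCoeffs {P : ℕ} (D : Fin (P + 1) → ℕ) :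
    (∀ j, degreeLT F (D j)) →ₗ[F] F[X][X] where
  toFun f := ∑ j : Fin (P + 1), monomial (j : ℕ) (f j : F[X])
  map_add' f g := by simp [Finset.sum_add_distrib]
  map_smul' c f := by
    rw [RingHom.id_apply, Finset.smul_sum]
    refine Finset.sum_congr rfl fun j _ => ?_
    rw [smul_monomial]
    rfl

theorem coeff_ofCoeffs {P : ℕ} (D : Fin (P + 1) → ℕ) (f : ∀ j, degreeLT F (D j))
    (j : Fin (P + 1)) : (ofCoeffs D f).coeff j = f j := by
  simp only [ofCoeffs, LinearMap.coe_mk, AddHom.coe_mk, finsetSum_coeff, coeff_monomial]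
  rw [Finset.sum_eq_single j] <;> simp +contextual [Fin.val_inj]

theorem natDegree_ofCoeffs_le {P : ℕ} (D : Fin (P + 1) → ℕ) (f : ∀ j, degreeLT F (D j)) :
    (ofCoeffs D f).natDegree ≤ P := by
  refine natDegree_sum_le_of_forall_le Finset.univ
    (fun j : Fin (P + 1) => monomial (j : ℕ) (f j : F[X])) fun j _ => ?_
  exact (natDegree_monomial_le _).trans (Nat.lt_succ_iff.mp j.2)

/-- Linear algebra: the left side of `hcount` counts the conditions, m(m+1)/2 per point, and the
right side the monomials with j ≤ P and i + wj < W. -/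
theorem exists_interpolant {n : ℕ} (pt : Fin n → F) (y : Fin n → Option F) (P m : ℕ) (W w : ℤ)
    (hcount : n * ∑ i ∈ Finset.range m, (m - i) <
      ∑ j ∈ Finset.range (P + 1), (W - w * j).toNat) :
    ∃ Q, IsInterpolant pt y P m Q ∧ wdeg w Q ≤ ((W - 1 : ℤ) : WithBot ℤ) := by
  let D : Fin (P + 1) → ℕ := fun j => (W - w * (j : ℕ)).toNat
  let T : (∀ j, degreeLT F (D j)) →ₗ[F] (Fin n × (Σ i : Fin m, Fin (m - i)) → F) :=
    LinearMap.pi fun p =>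
      (passCoeff P (pt p.1) p.2.1 p.2.2 (y p.1)).comp (ofCoeffs D)
  have hfin : ∀ j, Module.Finite F (degreeLT F (D j)) := fun j =>
    Module.Finite.equiv (degreeLTEquiv F (D j)).symm
  have hrank : ∀ j, Module.finrank F (degreeLT F (D j)) = D j := fun j => by
    rw [(degreeLTEquiv F (D j)).finrank_eq, Module.finrank_fin_fun]
  have hker : LinearMap.ker T ≠ ⊥ := by
    apply LinearMap.ker_ne_bot_of_finrank_lt
    rw [Module.finrank_fintype_fun_eq_card, Module.finrank_pi_fintype, Fintype.card_prod,
      Fintype.card_fin, Fintype.card_sigma]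
    simp only [Fintype.card_fin, hrank]
    rwa [Fin.sum_univ_eq_sum_range (fun i => m - i),
      Fin.sum_univ_eq_sum_range (fun j => (W - w * (j : ℕ)).toNat)]
  obtain ⟨f, hf, hf0⟩ := Submodule.exists_mem_ne_zero_of_ne_bot hker
  refine ⟨ofCoeffs D f, ⟨?_, natDegree_ofCoeffs_le D f, fun i => passes_iff.mpr ?_⟩, ?_⟩
  · intro h
    refine hf0 (funext fun j => Subtype.ext ?_)
    rw [← coeff_ofCoeffs, h]
    simp
  · intro a b hab
    exact congrFun (LinearMap.mem_ker.mp hf) ⟨i, ⟨a, by omega⟩, ⟨b, by dsimp only; omega⟩⟩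
  · refine Finset.sup_le fun j hj => Finset.sup_le fun i hi => ?_
    have hjP := (le_natDegree_of_mem_supp _ hj).trans (natDegree_ofCoeffs_le D f)
    have hcoeff := coeff_ofCoeffs D f ⟨j, Nat.lt_succ_of_le hjP⟩
    dsimp only at hcoeff
    rw [hcoeff, mem_support_iff] at hi
    have := mem_degreeLT.mp (f ⟨j, Nat.lt_succ_of_le hjP⟩).2
    have hiD : i < (W - w * (j : ℕ)).toNat := by
      by_contra! hle
      exact hi (coeff_eq_zero_of_degree_lt (this.trans_le (by exact_mod_cast hle)))
    exact_mod_cast (by omega : (i : ℤ) + w * j ≤ W - 1)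

/-- As w may be negative, a lower bound is needed before a minimum can be taken; the leading
coefficient in Y provides it. -/
theorem exists_wdeg_eq {P : ℕ} {Q : F[X][X]} (w : ℤ) (h0 : Q ≠ 0) (hP : Q.natDegree ≤ P) :
    ∃ z : ℤ, wdeg w Q = z ∧ -(|w| * P) ≤ z := by
  have hle : ((((Q.leadingCoeff.natDegree : ℤ) + w * (Q.natDegree : ℤ) : ℤ)) : WithBot ℤ) ≤
      wdeg w Q := by
    refine le_trans ?_ (Finset.le_sup (f := fun j => (Q.coeff j).support.sup fun i =>
      (((i : ℤ) + w * (j : ℤ) : ℤ) : WithBot ℤ)) (natDegree_mem_support_of_nonzero h0))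
    exact Finset.le_sup (f := fun i : ℕ => (((i : ℤ) + w * (Q.natDegree : ℤ) : ℤ) : WithBot ℤ))
      (natDegree_mem_support_of_nonzero (leadingCoeff_ne_zero.mpr h0))
  cases h : wdeg w Q with
  | bot => rw [h] at hle; exact absurd (le_bot_iff.mp hle) WithBot.coe_ne_bot
  | coe z =>
    refine ⟨z, rfl, ?_⟩
    rw [h, WithBot.coe_le_coe] at hle
    have h1 : -(|w| * Q.natDegree) ≤ w * Q.natDegree := by
      have := neg_abs_le w
      nlinarith [(Nat.cast_nonneg Q.natDegree : (0 : ℤ) ≤ _)]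
    have h2 : |w| * Q.natDegree ≤ |w| * P :=
      mul_le_mul_of_nonneg_left (by exact_mod_cast hP) (abs_nonneg w)
    omega

theorem IsInterpolant.exists_isMinInterpolant {n : ℕ} {pt : Fin n → F} {y : Fin n → Option F}
    {P m : ℕ} {Q : F[X][X]} (w : ℤ) (hQ : IsInterpolant pt y P m Q) :
    ∃ Q', IsMinInterpolant pt y P m w Q' := by
  obtain ⟨z, ⟨Q', hQ', hz⟩, hmin⟩ := Int.exists_least_of_bdd
    (P := fun z : ℤ => ∃ Q', IsInterpolant pt y P m Q' ∧ wdeg w Q' = z)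
    ⟨-(|w| * P), by
      rintro z ⟨Q', hQ', hz⟩
      obtain ⟨z', hz', hle⟩ := exists_wdeg_eq w hQ'.ne_zero hQ'.natDegree_le
      rw [hz, WithBot.coe_inj] at hz'
      exact hz' ▸ hle⟩
    (by
      obtain ⟨z, hz, -⟩ := exists_wdeg_eq w hQ.ne_zero hQ.natDegree_le
      exact ⟨z, Q, hQ, hz⟩)
  refine ⟨Q', hQ', fun Q'' hQ'' => ?_⟩
  obtain ⟨z'', hz'', -⟩ := exists_wdeg_eq w hQ''.ne_zero hQ''.natDegree_le
  rw [hz, hz'', WithBot.coe_le_coe]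
  exact hmin _ ⟨Q'', hQ'', hz''⟩

end Interpolation

/-! ### Arithmetic of the radius, the multiplicity and the Y-degree. -/

section Parameters

variable {n d t : ℕ}

/-- Squaring gives n(n - d) < (n - t)², which is the last inequality. It also excludes t ≥ d, where
(n - t)² ≤ (n - d)² ≤ n(n - d). -/
theorem johnson_condition (hdn : d ≤ n)
    (ht : (t : ℝ) < (n : ℝ) - √((n : ℝ) * ((n : ℝ) - (d : ℝ)))) :
    t ≤ n ∧ t < d ∧ (n : ℤ) * (2 * t - d) < t ^ 2 := by
  have hs := Real.sqrt_nonneg ((n : ℝ) * ((n : ℝ) - d))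
  have hdn' : (d : ℝ) ≤ n := by exact_mod_cast hdn
  have hn0 : (0 : ℝ) ≤ n := Nat.cast_nonneg n
  have hd0 : (0 : ℝ) ≤ d := Nat.cast_nonneg d
  have hlt := (Real.sqrt_lt' (by linarith)).mp
    (by linarith : √((n : ℝ) * ((n : ℝ) - (d : ℝ))) < (n : ℝ) - t)
  have htn : (t : ℝ) < n := by linarith
  refine ⟨by exact_mod_cast htn.le, ?_, ?_⟩
  · by_contra! hle
    have hle' : (d : ℝ) ≤ t := by exact_mod_cast hle
    nlinarith
  · have : (n : ℝ) * (2 * t - d) < t ^ 2 := by nlinarith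
    exact_mod_cast this

theorem multiplicity_spec (htn : t ≤ n) (hdt : d < 2 * t) (hJ : (n : ℤ) * (2 * t - d) < t ^ 2) :
    (2 * t - d : ℤ) * (n - t) < multiplicity n d t * (t ^ 2 - n * (2 * t - d) : ℤ) := by
  have hJ' : (0 : ℚ) < (t : ℚ) ^ 2 - n * (2 * t - d) := by
    rw [sub_pos]; exact_mod_cast hJ
  have h := Nat.lt_floor_add_one (2 * ((t : ℚ) - (d : ℚ) / 2) * ((n : ℚ) - t) /
    ((t : ℚ) ^ 2 - 2 * n * ((t : ℚ) - (d : ℚ) / 2)))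
  have hnn : (0 : ℚ) ≤ 2 * ((t : ℚ) - (d : ℚ) / 2) * ((n : ℚ) - t) /
      ((t : ℚ) ^ 2 - 2 * n * ((t : ℚ) - (d : ℚ) / 2)) := by
    have h1 : (d : ℚ) ≤ 2 * t := by exact_mod_cast hdt.le
    have h2 : (t : ℚ) ≤ n := by exact_mod_cast htn
    refine div_nonneg (mul_nonneg (by linarith) (by linarith)) (by linarith)
  rw [multiplicity, Nat.floor_add_one hnn]
  rw [div_lt_iff₀ (by linarith)] at h
  have h3 : (2 * t - d : ℚ) * (n - t) <
      ((⌊2 * ((t : ℚ) - (d : ℚ) / 2) * ((n : ℚ) - t) /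
        ((t : ℚ) ^ 2 - 2 * n * ((t : ℚ) - (d : ℚ) / 2))⌋₊ + 1 : ℕ) : ℚ) *
        (t ^ 2 - n * (2 * t - d)) := by
    push_cast
    linarith
  exact_mod_cast h3

theorem yDegree_spec (hdt : d < 2 * t) (m : ℕ) :
    (yDegree d t m : ℤ) * (2 * t - d) ≤ t * m ∧
      (t * m : ℤ) < (yDegree d t m + 1) * (2 * t - d) := by
  have hD : (0 : ℚ) < 2 * t - d := by
    rw [sub_pos]; exact_mod_cast hdt
  have h1 := Nat.floor_le (div_nonneg (by positivity : (0 : ℚ) ≤ t * m) hD.le)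
  have h2 := Nat.lt_floor_add_one ((t : ℚ) * m / (2 * (t : ℚ) - d))
  rw [le_div_iff₀ hD] at h1
  rw [div_lt_iff₀ hD] at h2
  constructor
  · have : (yDegree d t m : ℚ) * (2 * t - d) ≤ t * m := h1
    exact_mod_cast this
  · have : (t * m : ℚ) < (yDegree d t m + 1) * (2 * t - d) := h2
    exact_mod_cast this

/-- With D = 2t - d, D times the right side equals tm(tm + D) + (tm - PD)((P + 1)D - tm). The last
product is nonnegative because P = ⌊tm/D⌋, and tm(tm + D) exceeds D n m (m + 1) by the choice of m.
-/
theorem count_ineq {n t m P D : ℤ} (hD : 0 < D) (hm : 0 < m)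
    (hmJ : D * (n - t) < m * (t ^ 2 - n * D)) (hP : P * D ≤ t * m) (hP' : t * m < (P + 1) * D) :
    n * m * (m + 1) < (P + 1) * (2 * t * m - P * D) := by
  refine lt_of_mul_lt_mul_left ?_ hD.le
  have h1 : 0 ≤ (t * m - P * D) * ((P + 1) * D - t * m) :=
    mul_nonneg (by linarith) (by linarith)
  have h2 : 0 < m * (m * (t ^ 2 - n * D) - D * (n - t)) := mul_pos hm (by linarith)
  have h3 : D * ((P + 1) * (2 * t * m - P * D)) =
      t * m * (t * m + D) + (t * m - P * D) * ((P + 1) * D - t * m) := by ring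
  have h4 : m * (m * (t ^ 2 - n * D) - D * (n - t)) =
      t * m * (t * m + D) - D * (n * m * (m + 1)) := by ring
  linarith

theorem two_mul_sum_range_sub (m : ℕ) :
    2 * ∑ i ∈ Finset.range m, (m - i) = m * (m + 1) := by
  have h := Finset.sum_range_id_mul_two (m + 1)
  rw [← Finset.sum_range_reflect, Finset.sum_range_succ] at h
  simp only [Nat.add_sub_cancel, Nat.sub_self, add_zero] at h
  rw [mul_comm, h, mul_comm]

theorem two_mul_sum_range_linear (W w : ℤ) (P : ℕ) :
    2 * ∑ j ∈ Finset.range (P + 1), (W - w * j) = (P + 1) * (2 * W - w * P) := by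
  induction P with
  | zero => simp
  | succ P ih =>
    rw [Finset.sum_range_succ, mul_add, ih]
    push_cast
    ring

theorem count_lt {m P : ℕ} {D W w : ℤ} (hD : 0 < D) (hm : 0 < m)
    (hmJ : D * (n - t) < m * (t ^ 2 - n * D)) (hP : P * D ≤ t * m) (hP' : t * m < (P + 1) * D)
    (hW : 2 * W - w * P = 2 * t * m - P * D) :
    n * ∑ i ∈ Finset.range m, (m - i) < ∑ j ∈ Finset.range (P + 1), (W - w * j).toNat := by
  have h1 := count_ineq hD (by exact_mod_cast hm) hmJ hP hP'
  rw [← hW, ← two_mul_sum_range_linear] at h1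
  have h2 : ∑ j ∈ Finset.range (P + 1), (W - w * j) ≤
      ∑ j ∈ Finset.range (P + 1), ((W - w * j).toNat : ℤ) :=
    Finset.sum_le_sum fun j _ => Int.self_le_toNat _
  have h3 := two_mul_sum_range_sub m
  have h3' : (2 * (∑ i ∈ Finset.range m, (m - i) : ℕ) : ℤ) = m * (m + 1) := by exact_mod_cast h3
  have h4 : ((n * ∑ i ∈ Finset.range m, (m - i) : ℕ) : ℤ) <
      ((∑ j ∈ Finset.range (P + 1), (W - w * j).toNat : ℕ) : ℤ) := by
    rw [Nat.cast_mul, Nat.cast_sum (Finset.range (P + 1))]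
    have : (n : ℤ) * m * (m + 1) = 2 * (n * (∑ i ∈ Finset.range m, (m - i) : ℕ)) := by
      rw [mul_assoc, ← h3']; ring
    linarith
  exact_mod_cast h4

end Parameters

/-! ### Recovering a rational function from its truncated series. -/

section SeriesRecovery

variable {F : Type*} [Field F]

theorem X_pow_dvd_mul_trunc_sub {l b : F[X]} {s : PowerSeries F}
    (h : (l : PowerSeries F) * s = b) (L : ℕ) :
    X ^ L ∣ l * PowerSeries.trunc L s - b := by
  rw [X_pow_dvd_iff]
  intro j hj
  rw [coeff_sub, sub_eq_zero, ← coeff_coe b, ← h, PowerSeries.coeff_mul, coeff_mul]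
  refine Finset.sum_congr rfl fun p hp => ?_
  have := Finset.HasAntidiagonal.mem_antidiagonal.mp hp
  rw [PowerSeries.coeff_trunc, if_pos (by omega), coeff_coe]

/-- A rational function `b / l` in lowest terms is recovered from its truncated power series. -/
theorem lambdaOf_eq_and_bOf_eq (st : BMState F) (t : ℕ) {s l b : F[X]}
    (h : X ^ (t - st.LxB + 1 + 2 * (t - st.LΛ)) ∣ l * s - b) (hl0 : l.coeff 0 = 1)
    (hcop : IsCoprime l b) (hl : l.natDegree ≤ t - st.LΛ)
    (hb : b.degree < ((t - st.LxB + 1 : ℕ) : WithBot ℕ)) :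
    lambdaOf st t s = l ∧ bOf st t s = b := by
  set N := t - st.LxB + 1
  set ℓ := t - st.LΛ
  have hXN : (X : F[X]) ^ N ≠ 0 := pow_ne_zero _ X_ne_zero
  obtain ⟨g, hg⟩ := h
  have hs := modByMonic_add_div s (X ^ N)
  have hp : (s %ₘ X ^ N).degree < (N : ℕ) := by
    simpa using degree_modByMonic_lt s (monic_X_pow (R := F) N)
  set p := s %ₘ X ^ N
  set σ := s /ₘ X ^ N
  have hσ : ∀ j, σ.coeff j = s.coeff (N + j) := fun j => by
    rw [← hs, coeff_add, coeff_eq_zero_of_degree_lt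
      (hp.trans_le (by exact_mod_cast Nat.le_add_right _ _)), zero_add, add_comm N j, coeff_X_pow_mul]
  -- Dropping the first N terms of s leaves a tail congruent to w/l modulo X^(2ℓ), where deg w < ℓ
  -- because deg b < N: again a key equation.
  obtain ⟨w, hw⟩ : X ^ N ∣ b - l * p :=
    ⟨l * σ - X ^ (2 * ℓ) * g, by linear_combination -hg - l * hs⟩
  have hkey : X ^ (2 * ℓ) ∣ l * σ - w := by
    refine ⟨g, mul_left_cancel₀ hXN ?_⟩
    linear_combination hg + l * hs + hw
  have hdeg : w.degree < (ℓ : ℕ) := by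
    rcases eq_or_ne w 0 with rfl | hw0
    · simp
    have hlt : (b - l * p).degree < ((ℓ + N : ℕ) : WithBot ℕ) := by
      refine (degree_sub_le _ _).trans_lt (max_lt (hb.trans_le ?_) ?_)
      · exact_mod_cast Nat.le_add_left _ _
      · exact degree_mul_lt_of_natDegree_le hl hp le_rfl
    rw [hw, degree_eq_natDegree (mul_ne_zero hXN hw0), natDegree_mul hXN hw0, natDegree_X_pow,
      Nat.cast_lt] at hlt
    rw [degree_eq_natDegree hw0, Nat.cast_lt]
    omega
  have hcop' : IsCoprime l w := by
    refine IsCoprime.of_mul_right_right (y := X ^ N) ?_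
    rw [← hw, sub_eq_add_neg, ← mul_neg]
    exact hcop.add_mul_left_right _
  have hlam : lambdaOf st t s = l := by
    obtain ⟨Ω, Φ, hinv⟩ := berlekampMassey_invariant σ (fun j => s.coeff (N + j)) (2 * ℓ)
      fun j _ => hσ j
    obtain ⟨_, c, -, -, -, h1, h2, h3⟩ :=
      hinv.exists_coprime_combination hl hdeg hkey hl0 hcop'
    have hlen := berlekampMassey_length_add (fun j => s.coeff (N + j)) (2 * ℓ)
    -- The two lengths add up to 2ℓ + 1 and that of Λ is at most ℓ, so that of XB exceeds ℓ and its
    -- coefficient is zero.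
    exact (h3 (h2.resolve_right (by omega))).symm
  refine ⟨hlam, ?_⟩
  rw [bOf, hlam]
  have := div_modByMonic_unique (f := s * l) (g := X ^ N) (X ^ (2 * ℓ) * g) b (monic_X_pow N)
    ⟨by linear_combination -hg, by rwa [degree_X_pow]⟩
  exact this.2

end SeriesRecovery

/-! ### Correctness of the list decoder for generalized Reed–Solomon codes. -/

section Decoding

variable {F : Type*} [Field F] {n : ℕ} {x v : Fin n → F} {k : ℕ}

theorem syndrome_sub (x v R c : Fin n → F) (j : ℕ) :
    syndrome x v (R - c) j = syndrome x v R j - syndrome x v c j := by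
  simp [syndrome, sub_mul, Finset.sum_sub_distrib]

theorem bmOutput_invariant (x v : Fin n → F) (k : ℕ) (R : Fin n → F) :
    ∃ Ω Φ, (bmOutput x v k R).Invariant (seqPoly (syndrome x v R) (n - k)) Ω Φ (n - k) :=
  berlekampMassey_invariant _ _ _ fun _ hj => coeff_seqPoly _ hj

variable [DecidableEq F]

/-- The error locator polynomial of a codeword in terms of the Berlekamp-Massey state. -/
theorem exists_errorLocator_eq (hx : Function.Injective x) (h0 : ∀ i, x i ≠ 0)
    (hv : ∀ i, v i ≠ 0) (R : Fin n → F) {c : Fin n → F} (hc : c ∈ grsCode x v k) :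
    ∃ (E : Finset (Fin n)) (l b : F[X]), E.card = hammingDist R c ∧
      (E.card ≤ n - k → forney x v k (syndrome x v R) (errorLocator x E) = R - c) ∧
      errorLocator x E = l * (bmOutput x v k R).Λ + b * (X * (bmOutput x v k R).B) ∧
      l.coeff 0 = 1 ∧ IsCoprime l b ∧ l.natDegree + (bmOutput x v k R).LΛ ≤ E.card ∧
      (b = 0 ∨ b.natDegree + (bmOutput x v k R).LxB ≤ E.card) ∧
      (b = 0 → errorLocator x E = (bmOutput x v k R).Λ) := by
  let E : Finset (Fin n) := Finset.univ.filter fun i => R i ≠ c i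
  have hE : ∀ i ∉ E, (R - c) i = 0 := fun i hi => by
    simpa [E, sub_eq_zero] using hi
  have hS : ∀ j < n - k, syndrome x v R j = syndrome x v (R - c) j := fun j hj => by
    rw [syndrome_sub, hc j hj, sub_zero]
  have hkey := errorLocator_key x v (R - c) E hE (n - k)
  rw [← seqPoly_congr hS] at hkey
  obtain ⟨Ω, Φ, hinv⟩ := bmOutput_invariant x v k R
  obtain ⟨l, b, h1, h2, h3, h4, h5, h6⟩ := hinv.exists_coprime_combination
    (natDegree_errorLocator_le x E) (degree_locatorEvaluator_lt _ _ _) hkey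
    (coeff_zero_errorLocator x E) (isCoprime_errorLocator_locatorEvaluator hx h0 fun i hi =>
      mul_ne_zero (by simpa [E, sub_eq_zero] using hi) (hv i))
  exact ⟨E, l, b, rfl, fun hcard => forney_errorLocator hx h0 hv hE hcard hS, h1, h2, h3, h4, h5, h6⟩

theorem hammingDist_sub_forney_le (R : Fin n → F) (S : ℕ → F) (A : F[X]) :
    hammingDist R (R - forney x v k S A) ≤ (rootPositions x A).card := by
  refine Finset.card_le_card fun i hi => ?_
  by_contra h
  have hi := (Finset.mem_filter.mp hi).2
  rw [Pi.sub_apply, forney, if_neg h, sub_zero] at hi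
  exact hi rfl

/-- At an error position lΛ + bXB = 0, so b/l passes through the interpolation point there. This
forces more zeros, with multiplicity, than the degree allows. -/
theorem homEval_eq_zero {R : Fin n → F} (hx : Function.Injective x) (h0 : ∀ i, x i ≠ 0)
    {E : Finset (Fin n)} {l b : F[X]} {P m t : ℕ} {Q : F[X][X]}
    (hPm : m ≤ P) (hEt : E.card ≤ t)
    (hE : errorLocator x E = l * (bmOutput x v k R).Λ + b * (X * (bmOutput x v k R).B))
    (hl0 : l.coeff 0 = 1) (hcop : IsCoprime l b)
    (hl : l.natDegree + (bmOutput x v k R).LΛ ≤ E.card)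
    (hb : b = 0 ∨ b.natDegree + (bmOutput x v k R).LxB ≤ E.card)
    (hQ : IsInterpolant (fun i => (x i)⁻¹) (fun i => ordinate (bmOutput x v k R) (x i)⁻¹) P m Q)
    (hdeg : wdeg (((bmOutput x v k R).LΛ : ℤ) - ((bmOutput x v k R).LxB : ℤ)) Q ≤
      ((t * m - P * (t - (bmOutput x v k R).LΛ) - 1 : ℤ) : WithBot ℤ)) :
    homEval P Q b l = 0 := by
  obtain ⟨Ω, Φ, hinv⟩ := bmOutput_invariant x v k R
  set st := bmOutput x v k R
  have hl_ne : l ≠ 0 := by rintro rfl; simp at hl0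
  refine eq_zero_of_forall_pow_dvd hx (E := E) (m := m) (fun i hi => ?_) ?_
  · have ha : (x i)⁻¹ ≠ 0 := inv_ne_zero (h0 i)
    have hroot : (errorLocator x E).eval (x i)⁻¹ = 0 := by
      rwa [← mem_rootPositions, rootPositions_errorLocator hx h0]
    have hpass := hQ.passes i
    rw [hE] at hroot
    simp only [eval_add, eval_mul, eval_X] at hroot
    generalize (x i)⁻¹ = a at *
    rw [ordinate] at hpass
    split_ifs at hpass with hB
    -- At y = ∞, B(a) = 0 forces Λ(a) ≠ 0 by the determinant; hence l(a) = 0 and b/l has a pole.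
    · have hla : l.eval a = 0 := by
        rw [hB, mul_zero, mul_zero, add_zero] at hroot
        exact (mul_eq_zero.mp hroot).resolve_right (hinv.eval_Λ_ne_zero ha hB)
      have hb_ne : b ≠ 0 := by
        rintro rfl
        obtain ⟨u, w, huw⟩ := hcop
        simpa [hla] using congrArg (eval a) huw
      rw [← homEval_companion]
      exact PassesFin.dvd_homEval hpass (natDegree_companion_le P Q) hb_ne (by rw [hla, zero_mul])
    · refine PassesFin.dvd_homEval hpass hQ.natDegree_le hl_ne ?_
      field_simp
      linear_combination hroot
  · refine (natDegree_homEval_le (D := t * m - P * (t - st.LΛ) - 1) (α := E.card - st.LΛ)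
      (β := E.card - st.LxB) ?_ (by omega) (hb.imp_right fun h => by omega)).imp_right fun h => ?_
    · rwa [sub_sub_sub_cancel_left]
    · have : (((homEval P Q b l).natDegree : ℕ) : ℤ) < (E.card * m : ℕ) := by
        push_cast
        -- The degree is at most tm - 1 - P(t - e) with e = |E|; since P ≥ m, this is below em for
        -- every e ≤ t and not only for e = t.
        have h1 : (0 : ℤ) ≤ (t - E.card) * (P - m) :=
          mul_nonneg (by omega) (by omega)
        nlinarith
      exact_mod_cast this

variable [Fintype F]

theorem mem_decodeWith_iff {R : Fin n → F} (hx : Function.Injective x) (h0 : ∀ i, x i ≠ 0)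
    (hv : ∀ i, v i ≠ 0) {P m t : ℕ} {Q : F[X][X]} (hPm : m ≤ P) (htk : t ≤ n - k)
    (hLΛ : (bmOutput x v k R).LΛ ≤ t) (hLxB : (bmOutput x v k R).LxB ≤ t)
    (hQ : IsInterpolant (fun i => (x i)⁻¹) (fun i => ordinate (bmOutput x v k R) (x i)⁻¹) P m Q)
    (hdeg : wdeg (((bmOutput x v k R).LΛ : ℤ) - ((bmOutput x v k R).LxB : ℤ)) Q ≤
      ((t * m - P * (t - (bmOutput x v k R).LΛ) - 1 : ℤ) : WithBot ℤ)) (c : Fin n → F) :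
    c ∈ decodeWith x v k t R Q ↔ c ∈ grsCode x v k ∧ hammingDist R c ≤ t := by
  classical
  simp only [decodeWith, Finset.mem_filter, Finset.mem_image]
  refine ⟨And.right, fun hc => ⟨?_, hc⟩⟩
  obtain ⟨E, l, b, hcard, hforney, hE, hl0, hcop, hl, hb, -⟩ :=
    exists_errorLocator_eq hx h0 hv R hc.1
  have hEt : E.card ≤ t := hcard ▸ hc.2
  have hzero := homEval_eq_zero hx h0 hPm hEt hE hl0 hcop hl hb hQ hdeg
  have hlc : PowerSeries.constantCoeff (l : PowerSeries F) ≠ 0 := by simp [hl0]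
  have hlb : (l : PowerSeries F) * ((l : PowerSeries F)⁻¹ * b) = b := by
    rw [← mul_assoc, PowerSeries.mul_inv_cancel _ hlc, one_mul]
  set s := (l : PowerSeries F)⁻¹ * b
  have hs : Q.eval₂ coeToPowerSeries.ringHom s = 0 := by
    have := map_homEval coeToPowerSeries.ringHom hQ.natDegree_le (u := b) (w := l) (s := s)
      (by simpa using hlb.symm)
    rw [hzero, map_zero] at this
    refine (mul_eq_zero.mp this.symm).resolve_left (pow_ne_zero _ ?_)
    intro h
    rw [coeToPowerSeries.ringHom_apply] at h
    simp [h] at hlc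
  obtain ⟨h1, h2⟩ := lambdaOf_eq_and_bOf_eq (bmOutput x v k R) t
    (X_pow_dvd_mul_trunc_sub hlb _) hl0 hcop (by omega) (by
      rcases hb with rfl | hb
      · simp
      · exact degree_le_natDegree.trans_lt (by exact_mod_cast (by omega)))
  have hcand : candidateLocator (bmOutput x v k R) t (PowerSeries.trunc
      (t - (bmOutput x v k R).LxB + 1 + 2 * (t - (bmOutput x v k R).LΛ)) s) =
      errorLocator x E := by
    rw [candidateLocator, h1, h2, hE]
  refine ⟨errorLocator x E, ⟨⟨_, trunc_mem_rationalFactorization _ _ _ hs, hcand⟩, ?_⟩, ?_⟩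
  · rw [rootPositions_errorLocator hx h0, natDegree_errorLocator h0]
  · rw [hforney (by omega), sub_sub_cancel]

theorem isOutput_correct (hx : Function.Injective x) (h0 : ∀ i, x i ≠ 0) (hv : ∀ i, v i ≠ 0)
    {d t m P : ℕ} (hk : 1 ≤ k) (hkn : k ≤ n) (hd : d = n - k + 1)
    (ht : (t : ℝ) < (n : ℝ) - √((n : ℝ) * ((n : ℝ) - (d : ℝ)))) (ht₀ : 2 * t ≠ d)
    (hm : m = multiplicity n d t) (hP : P = yDegree d t m) (R : Fin n → F) :
    (∃ out, IsOutput x v k t m P R out) ∧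
      ∀ out, IsOutput x v k t m P R out →
        ∀ c, c ∈ out ↔ c ∈ grsCode x v k ∧ hammingDist R c ≤ t := by
  obtain ⟨htn, htd, hJ⟩ := johnson_condition (by omega) ht
  have hlen : (bmOutput x v k R).LΛ + (bmOutput x v k R).LxB = d := by
    rw [bmOutput, berlekampMassey_length_add, hd]
  simp only [IsOutput]
  split_ifs with h1 h2 h3
  · refine ⟨⟨_, rfl⟩, ?_⟩
    rintro _ rfl c
    refine ⟨fun h => absurd h (Finset.notMem_empty _), fun hc => ?_⟩
    obtain ⟨E, l, b, hcard, -, -, -, -, hl, -⟩ := exists_errorLocator_eq hx h0 hv R hc.1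
    omega
  · refine ⟨⟨_, rfl⟩, ?_⟩
    rintro _ rfl c
    rw [Finset.mem_singleton]
    constructor
    · rintro rfl
      refine ⟨fun j hj => ?_, ?_⟩
      · obtain ⟨Ω, Φ, hinv⟩ := bmOutput_invariant x v k R
        rw [syndrome_sub, syndrome_forney hx h0 hv (by omega) hinv.natDegree_Λ hinv.coeff_zero h3
          hinv.key_Λ hinv.degree_Ω hj, sub_self]
      · exact (hammingDist_sub_forney_le R _ _).trans (by omega)
    · intro hc
      obtain ⟨E, l, b, hcard, hforney, -, -, -, hl, hb, hE⟩ :=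
        exists_errorLocator_eq hx h0 hv R hc.1
      rw [← hE (hb.resolve_right (by omega)), hforney (by omega), sub_sub_cancel]
  · refine ⟨⟨_, rfl⟩, ?_⟩
    rintro _ rfl c
    refine ⟨fun h => absurd h (Finset.notMem_empty _), fun hc => absurd ?_ h3⟩
    obtain ⟨E, l, b, hcard, hforney, -, -, -, hl, hb, hE⟩ :=
      exists_errorLocator_eq hx h0 hv R hc.1
    obtain ⟨Ω, Φ, hinv⟩ := bmOutput_invariant x v k R
    have hE := hE (hb.resolve_right (by omega))
    have hdeg := natDegree_errorLocator h0 E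
    have := hinv.natDegree_Λ
    rw [hE] at hdeg
    rw [← hE, rootPositions_errorLocator hx h0]
    omega
  -- Both lengths are at most t and sum to d, so d ≤ 2t; equality is excluded by `ht₀`.
  · have hdt : d < 2 * t := by omega
    have hmult := multiplicity_spec htn hdt hJ
    rw [← hm] at hmult
    obtain ⟨hP1, hP2⟩ := yDegree_spec hdt m
    rw [← hP] at hP1 hP2
    have hm0 : 0 < m := by
      by_contra! hm0
      obtain rfl : m = 0 := by omega
      have : (0 : ℤ) ≤ (2 * t - d : ℤ) * (n - t) := mul_nonneg (by omega) (by omega)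
      simp at hmult
      omega
    -- From t < d follows 2t - d ≤ t, hence m ≤ tm/(2t - d).
    have hPm : m ≤ P := by
      have : (m * (2 * t - d) : ℤ) < (P + 1) * (2 * t - d) := by
        refine lt_of_le_of_lt ?_ hP2
        rw [mul_comm]
        exact mul_le_mul_of_nonneg_right (by omega) (by omega)
      have := lt_of_mul_lt_mul_right this (by omega)
      omega
    obtain ⟨Q₀, hQ₀, hdeg₀⟩ := exists_interpolant (fun i => (x i)⁻¹)
      (fun i => ordinate (bmOutput x v k R) (x i)⁻¹) P m
      (t * m - P * (t - (bmOutput x v k R).LΛ))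
      (((bmOutput x v k R).LΛ : ℤ) - ((bmOutput x v k R).LxB : ℤ))
      -- Because L_Λ + L_{xB} = d, the average bound over j = 0, …, P does not depend on the
      -- individual lengths.
      (count_lt (by omega : (0 : ℤ) < 2 * t - d) hm0 hmult hP1 hP2 (by
        have : (d : ℤ) = (bmOutput x v k R).LΛ + (bmOutput x v k R).LxB := by omega
        rw [this]; ring))
    refine ⟨?_, ?_⟩
    · obtain ⟨Q, hQ⟩ := hQ₀.exists_isMinInterpolant
        (((bmOutput x v k R).LΛ : ℤ) - ((bmOutput x v k R).LxB : ℤ))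
      exact ⟨_, Q, hQ, rfl⟩
    · rintro _ ⟨Q, hQ, rfl⟩
      exact mem_decodeWith_iff hx h0 hv hPm (by omega) (by omega) (by omega)
        hQ.toIsInterpolant ((hQ.minimal _ hQ₀).trans hdeg₀)

end Decoding

/-! ### Reed–Solomon codes as generalized Reed–Solomon codes. -/

section ReedSolomon

variable {F : Type*} [Field F]

theorem eval_wordPoly {n : ℕ} (c : Fin n → F) {α : F} (hα : α ≠ 0) (m₀ : ℤ) (j : ℕ) :
    (wordPoly c).eval (α ^ (m₀ + j)) = syndrome (fun i : Fin n => α ^ (i : ℕ))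
      (fun i : Fin n => α ^ (m₀ * ((i : ℕ) : ℤ))) c j := by
  rw [wordPoly, eval_finsetSum, syndrome]
  refine Finset.sum_congr rfl fun i _ => ?_
  rw [eval_mul, eval_C, eval_pow, eval_X, mul_assoc]
  congr 1
  rw [← zpow_natCast (α ^ (m₀ + j)), ← zpow_mul, ← pow_mul, ← zpow_natCast α, ← zpow_add₀ hα]
  congr 1
  push_cast
  ring

/-- The syndromes are the values of the word polynomial at the roots of the generator, and these
roots are distinct since n ≤ N. -/
theorem rsCode_eq_grsCode {α : F} (hα : α ≠ 0) {N : ℕ} (hprim : IsPrimitiveRoot α N) (m₀ : ℤ)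
    {n : ℕ} (hn : n ≤ N) (k : ℕ) :
    rsCode α m₀ n k = grsCode (fun i : Fin n => α ^ (i : ℕ))
      (fun i : Fin n => α ^ (m₀ * ((i : ℕ) : ℤ))) k := by
  ext c
  simp only [rsCode, grsCode, Set.mem_ofPred_eq, ← eval_wordPoly c hα]
  constructor
  · intro h j hj
    exact dvd_iff_isRoot.mp
      ((Finset.dvd_prod_of_mem (fun i : ℕ => X - C (α ^ (m₀ + (i : ℤ))))
        (Finset.mem_range.mpr hj)).trans h)
  · intro h
    refine Finset.prod_dvd_of_coprime (fun i hi j hj hij => ?_) fun j hj =>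
      dvd_iff_isRoot.mpr (h j (Finset.mem_range.mp hj))
    refine isCoprime_X_sub_C_of_isUnit_sub (sub_ne_zero.mpr fun heq => hij ?_).isUnit
    rw [zpow_add₀ hα, zpow_add₀ hα, mul_right_inj' (zpow_ne_zero _ hα), zpow_natCast,
      zpow_natCast] at heq
    simp only [Finset.coe_range, Set.mem_Iio] at hi hj
    exact hprim.pow_inj (by omega) (by omega) heq

end ReedSolomon

end WuListDecoding

theorem theorem2 {F : Type*} [Field F] [Fintype F] [DecidableEq F] (n k d t : ℕ)
    (hk : 1 ≤ k) (hkn : k ≤ n) (hd : d = n - k + 1)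
    (ht : (t : ℝ) < (n : ℝ) - √((n : ℝ) * ((n : ℝ) - (d : ℝ))))
    (ht₀ : 2 * t ≠ d)
    (m P : ℕ) (hm : m = WuListDecoding.multiplicity n d t)
    (hP : P = WuListDecoding.yDegree d t m) :
    -- Reed-Solomon codes
    (∀ (α : F) (m₀ : ℤ), IsPrimitiveRoot α (Fintype.card F - 1) → n < Fintype.card F →
      ∀ R : Fin n → F,
        (∃ out, WuListDecoding.IsOutput (fun i : Fin n => α ^ (i : ℕ))
          (fun i : Fin n => α ^ (m₀ * ((i : ℕ) : ℤ))) k t m P R out) ∧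
        ∀ out, WuListDecoding.IsOutput (fun i : Fin n => α ^ (i : ℕ))
          (fun i : Fin n => α ^ (m₀ * ((i : ℕ) : ℤ))) k t m P R out →
          ∀ c, c ∈ out ↔ c ∈ WuListDecoding.rsCode α m₀ n k ∧ hammingDist R c ≤ t) ∧
    -- generalized Reed-Solomon codes
    (∀ x v : Fin n → F, Function.Injective x → (∀ i, x i ≠ 0) → (∀ i, v i ≠ 0) →
      ∀ R : Fin n → F,
        (∃ out, WuListDecoding.IsOutput x v k t m P R out) ∧
        ∀ out, WuListDecoding.IsOutput x v k t m P R out →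
          ∀ c, c ∈ out ↔ c ∈ WuListDecoding.grsCode x v k ∧ hammingDist R c ≤ t) ∧
    -- the bound on `t` is the Johnson radius
    (n : ℝ) - √((n : ℝ) * ((n : ℝ) - (d : ℝ))) = (n : ℝ) * (1 - √(1 - (d : ℝ) / (n : ℝ))) := by
  refine ⟨fun α m₀ hα hn R => ?_, fun x v hx h0 hv R =>
    WuListDecoding.isOutput_correct hx h0 hv hk hkn hd ht ht₀ hm hP R, ?_⟩
  · have hα0 : α ≠ 0 := hα.ne_zero (by omega)
    rw [WuListDecoding.rsCode_eq_grsCode hα0 hα m₀ (by omega)]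
    refine WuListDecoding.isOutput_correct (fun i j hij => Fin.ext ?_) (fun i => pow_ne_zero _ hα0)
      (fun i => zpow_ne_zero _ hα0) hk hkn hd ht ht₀ hm hP R
    exact hα.pow_inj (by omega) (by omega) hij
  · have hn : (0 : ℝ) < n := by exact_mod_cast (by omega : 0 < n)
    have h : (n : ℝ) * ((n : ℝ) - d) = (n : ℝ) ^ 2 * (1 - d / n) := by field_simp
    rw [h, Real.sqrt_mul (sq_nonneg _), Real.sqrt_sq hn.le]
    ring
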